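/- **Setting.** Let $M\ge 2$, $\sigma>0$, $\rho>0$, let $B\in\mathbb R^{d\times d}$ with $I_d-B$ invertible, and $b\in\mathbb R^d$. For $m=1,\dots,M$ the $m$-th source law $P^{(m)}$ is the law of the solution $(X,Y)\in\mathbb R^d\times\mathbb R$ of $X=BX+Yb+a^{(m)}_X+\varepsilon_X$, $Y=a^{(m)}_Y+\varepsilon_Y$, and the target law $\widetilde P$ is the law of the solution of the same equations with $(\tilde a_X,\tilde a_Y)$ in place of $(a_X^{(m)},a_Y^{(m)})$. In all environments $(\varepsilon_X,\varepsilon_Y)$ has the same law, which is square integrable with $E\varepsilon_X=0$, $E[\varepsilon_X\varepsilon_X^\top]=\Sigma=\frac{\sigma^2}{\rho}I_d$, $E\varepsilon_Y=0$, $E\varepsilon_Y^2=\sigma^2$, $E[\varepsilon_Y\varepsilon_X]=0$ and $E[\varepsilon_X\mid\varepsilon_Y]=0$. For every $m$ the laws of the label in source $m$ and in source $1$ are not mutually singular. Let $V=\mathrm{span}(a^{(2)}_X-a^{(1)}_X,\dots,a^{(M)}_X-a^{(1)}_X)$ and let $\Pi_V$ be the orthogonal projection onto $V$. Put $$\bar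 a_Y=\tfrac1M\sum_m a_Y^{(m)},\quad \Delta_Y=\tfrac1M\sum_m(a_Y^{(m)}-\bar a_Y)^2,\quad N_Y=(\tilde a_Y-\bar a_Y)^2-\Delta_Y,\quad D(\kappa)=1+\rho\Bigl(1+\frac{\Delta_Y}{\sigma^2}\Bigr)\kappa .$$ **Estimators.** All are affine, $f(x)=x^\top\beta+\beta_0$, and $\tilde R(f)=E_{\widetilde P}(f(X)-Y)^2$. OLSTar minimizes $\tilde R(f)$ over $(\beta,\beta_0)$. CIP minimizes $\frac1M\sum_m E_{P^{(m)}}(Y-X^\top\beta-\beta_0)^2$ subject to $E_{P^{(m)}}[X^\top\beta\mid Y]=E_{P^{(1)}}[X^\top\beta\mid Y]$ a.s. for $m=2,\dots,M$ (that is, both conditional expectations are given by a common function of the label). CIRM$^{(m)}$ minimizes $E_{P^{(m)}}(Y-X^\top\beta-\beta_0)^2$ subject to $E_{P^{(m)}}[\beta^\top(X-(X^\top\beta_{\rm CIP})\vartheta)]=E_{\widetilde P}[\beta^\top(X-(X^\top\beta_{\rm CIP})\vartheta)]$, where $$\vartheta=\frac{\frac1M\sum_jE_{P^{(j)}}[X\,(Y-E_{P^{(j)}}Y)]}{\frac1M\sum_jE_{P^{(j)}}[(X^\top\beta_{\rm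 CIP}-E_{P^{(j)}}X^\top\beta_{\rm CIP})(Y-E_{P^{(j)}}Y)]};$$ it is defined only when this denominator is not $0$. **(a) Exact risks.** Suppose $\dim V\le d-1$ and $\tilde a_X-a_X^{(1)}\in V$. Then OLSTar and CIP exist and are unique, for every $m$ CIRM$^{(m)}$ exists and is unique if $b\notin V$, and, with $\kappa=\|b\|_2^2-\|\Pi_Vb\|_2^2$, with $u^{(m)}=(a_X^{(m)}-\tilde a_X)/\|a_X^{(m)}-\tilde a_X\|_2$ ($u^{(m)}=0$ if $a_X^{(m)}=\tilde a_X$) and with $K_m=1+\rho\|b\|_2^2-\rho({u^{(m)}}^\top b)^2$, $$\tilde R(f_{\rm OLSTar})=\frac{\sigma^2}{1+\rho\|b\|_2^2},\qquad \tilde R(f_{\rm CIP})=\frac{\sigma^2+\Delta_Y}{D(\kappa)}+\frac{N_Y}{D(\kappa)^2},\qquad \tilde R(f_{\rm CIRM}^{(m)})=\frac{\sigma^2}{K_m}+\frac{(\tilde a_Y-a_Y^{(m)})^2}{K_m^2},$$ the last one whenever CIRM$^{(m)}$ is defined. **(b) Gaussian interventions.** Suppose instead that $a^{(2)}_X-a^{(1)}_X,\dots,a^{(M)}_X-a^{(1)}_X,\xi$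 are independent with law $\mathcal N(0,\tau^2I_d)$, $\tau>0$, that $\tilde a_X-a_X^{(1)}=\Pi_V\xi$, that $d\ge 6M$ and that $0<t\le d/2$. Then for every $m\in\{1,\dots,M\}$, with probability at least $$\bigl(1-2e^{-d/32}-2e^{-M/32}\bigr)^+\cdot\bigl(1-e^{-t/16}-2e^{-t/4}\bigr)^+$$ (where $x^+=\max(x,0)$) all of the following hold: $\dim V=M-1$; CIP exists and is unique; CIRM$^{(m)}$ exists and is unique if $b\ne0$; with $D_1=D\bigl((1-\tfrac{3(M-1)}d)\|b\|_2^2\bigr)$ and $D_2=D\bigl((1-\tfrac{M-1}{3d})\|b\|_2^2\bigr)$, $$\frac{\sigma^2+\Delta_Y}{D_2}+\frac{N_Y}{D_2^2}\le\tilde R(f_{\rm CIP})\le\frac{\sigma^2+\Delta_Y}{D_1}+\frac{N_Y}{D_1^2}\quad\text{if }N_Y\ge0,$$ $$\frac{\sigma^2+\Delta_Y}{D_2}+\frac{N_Y}{D_1^2}\le\tilde R(f_{\rm CIP})\le\frac{\sigma^2+\Delta_Y}{D_1}+\frac{N_Y}{D_2^2}\quad\text{if }N_Y<0;$$ and, whenever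 CIRM$^{(m)}$ is defined, $$\tilde R(f_{\rm CIRM}^{(m)})\le\frac{\sigma^2}{1+\rho(1-\frac td)\|b\|_2^2}+\frac{(\tilde a_Y-a_Y^{(m)})^2}{\bigl[1+\rho(1-\frac td)\|b\|_2^2\bigr]^2}.$$ -/

import Mathlib

open MeasureTheory ProbabilityTheory

namespace AnticausalDA

noncomputable section

/-- The covariate space `ℝ^d` with its Euclidean norm. -/
abbrev E (d : ℕ) : Type := EuclideanSpace ℝ (Fin d)

/-- The data of an anticausal linear structural causal model on `(X, Y) ∈ ℝ^d × ℝ`: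
`X = B X + Y b + a_X + ε_X` and `Y = a_Y + ε_Y`. The joint law of the noise `(ε_X, ε_Y)` is
`noise`; it is the same in all environments, and only `(a_X, a_Y)` changes. -/
structure SCM (d : ℕ) where
  B : Matrix (Fin d) (Fin d) ℝ
  b : E d
  noise : Measure (E d × ℝ)

namespace SCM

variable {d : ℕ}

/-- The assumptions on the model; `Sig` is the covariance matrix of `ε_X` and `σ ^ 2` the
variance of `ε_Y`. -/
structure IsAnticausal (S : SCM d) (σ : ℝ) (Sig : Matrix (Fin d) (Fin d) ℝ) : Prop where
  isProb : IsProbabilityMeasure S.noise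
  invertible : IsUnit (1 - S.B)
  memLp_X : MemLp (fun e : E d × ℝ => e.1) 2 S.noise
  memLp_Y : MemLp (fun e : E d × ℝ => e.2) 2 S.noise
  mean_X : ∫ e, e.1 ∂S.noise = 0
  cov_X : ∀ i j, ∫ e, e.1 i * e.1 j ∂S.noise = Sig i j
  mean_Y : ∫ e, e.2 ∂S.noise = 0
  var_Y : ∫ e, e.2 ^ 2 ∂S.noise = σ ^ 2
  uncorrelated : ∫ e, e.2 • e.1 ∂S.noise = 0
  /-- `E[ε_X | ε_Y] = 0`. -/
  condMean : S.noise[fun e => e.1 | MeasurableSpace.comap Prod.snd inferInstance] =ᵐ[S.noise] 0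

/-- The label generated from the noise `e = (ε_X, ε_Y)`. -/
def Y (aY : ℝ) (e : E d × ℝ) : ℝ := aY + e.2

/-- The covariate generated from the noise `e = (ε_X, ε_Y)`:
the solution `(I - B)⁻¹ (Y b + a_X + ε_X)` of the structural equation. -/
def X (S : SCM d) (aX : E d) (aY : ℝ) (e : E d × ℝ) : E d :=
  Matrix.toEuclideanLin ((1 - S.B)⁻¹) (Y aY e • S.b + aX + e.1)

/-- `x` solves the structural equation of the covariate iff it is `S.X aX aY e`. -/
theorem structural_iff (S : SCM d) (h : IsUnit (1 - S.B)) (aX : E d) (aY : ℝ) (e : E d × ℝ)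
    (x : E d) :
    x = Matrix.toEuclideanLin S.B x + Y aY e • S.b + aX + e.1 ↔ x = S.X aX aY e := by
  have hdet : IsUnit (1 - S.B).det := (Matrix.isUnit_iff_isUnit_det _).1 h
  set w : E d := Y aY e • S.b + aX + e.1 with hw
  have h1 : (x = Matrix.toEuclideanLin S.B x + Y aY e • S.b + aX + e.1) ↔
      Matrix.toEuclideanLin (1 - S.B) x = w := by
    have : Matrix.toEuclideanLin (1 - S.B) x = x - Matrix.toEuclideanLin S.B x := by
      ext i
      simp [Matrix.toLpLin_apply]
    rw [this, sub_eq_iff_eq_add, hw]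
    rw [add_comm _ (Matrix.toEuclideanLin S.B x), ← add_assoc, ← add_assoc]
  rw [h1]
  have hm : ∀ (A C : Matrix (Fin d) (Fin d) ℝ) (z : E d),
      Matrix.toEuclideanLin A (Matrix.toEuclideanLin C z) = Matrix.toEuclideanLin (A * C) z := by
    intro A C z
    ext i
    simp [Matrix.toLpLin_apply, Matrix.mulVec_mulVec]
  have hone : ∀ z : E d, Matrix.toEuclideanLin (1 : Matrix (Fin d) (Fin d) ℝ) z = z := by
    intro z
    ext i
    simp
  have hl : ∀ z, Matrix.toEuclideanLin (1 - S.B)⁻¹ (Matrix.toEuclideanLin (1 - S.B) z) = z := by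
    intro z
    rw [hm, Matrix.nonsing_inv_mul _ hdet, hone]
  have hr : ∀ z, Matrix.toEuclideanLin (1 - S.B) (Matrix.toEuclideanLin (1 - S.B)⁻¹ z) = z := by
    intro z
    rw [hm, Matrix.mul_nonsing_inv _ hdet, hone]
  constructor
  · intro hx; rw [X, ← hw, ← hx, hl]
  · intro hx; rw [hx, X, ← hw, hr]

/-- The law of `(X, Y)` in the environment with intervention `(a_X, a_Y)`. -/
def law (S : SCM d) (aX : E d) (aY : ℝ) : Measure (E d × ℝ) :=
  S.noise.map fun e => (S.X aX aY e, Y aY e)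

/-- The law of the label in an environment with label intervention `a_Y`. -/
def labelLaw (S : SCM d) (aY : ℝ) : Measure ℝ := S.noise.map fun e => Y aY e

end SCM

variable {d M : ℕ}

/-- The affine predictor `x ↦ xᵀβ + β₀` with parameters `p = (β, β₀)`. -/
def affine (p : E d × ℝ) (x : E d) : ℝ := inner ℝ p.1 x + p.2

/-- The population risk of `f` under the law `P` of `(X, Y)`, for the squared loss. -/
def risk (P : Measure (E d × ℝ)) (f : E d → ℝ) : ℝ := ∫ z, (f z.1 - z.2) ^ 2 ∂P

/-- `p` is a population least squares estimator under `P` (OLSTar when `P` is the target law). -/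
def IsOLS (P : Measure (E d × ℝ)) (p : E d × ℝ) : Prop :=
  ∀ q : E d × ℝ, risk P (affine p) ≤ risk P (affine q)

/-- `E_P[Xᵀβ | Y] = E_Q[Xᵀβ | Y]` almost surely: the two conditional expectations are given by a
common function of the label. -/
def CondMeanEq (P Q : Measure (E d × ℝ)) (β : E d) : Prop :=
  ∃ φ : ℝ → ℝ, Measurable φ ∧
    P[fun z => inner ℝ β z.1 | MeasurableSpace.comap Prod.snd inferInstance]
      =ᵐ[P] (fun z => φ z.2) ∧
    Q[fun z => inner ℝ β z.1 | MeasurableSpace.comap Prod.snd inferInstance]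
      =ᵐ[Q] (fun z => φ z.2)

/-- The risk averaged over the source environments. -/
def avgRisk (P : Fin M → Measure (E d × ℝ)) (f : E d → ℝ) : ℝ := (∑ m, risk (P m) f) / M

/-- `p` is the CIP-mean estimator for the source laws `P` (the first source has index `0`). -/
def IsCIP [NeZero M] (P : Fin M → Measure (E d × ℝ)) (p : E d × ℝ) : Prop :=
  (∀ m, m ≠ 0 → CondMeanEq (P m) (P 0) p.1) ∧
    ∀ q : E d × ℝ, (∀ m, m ≠ 0 → CondMeanEq (P m) (P 0) q.1) →
      avgRisk P (affine p) ≤ avgRisk P (affine q)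

/-- The average over the sources of `E[X (Y - E Y)]`, the inner mean being that of the same
source. -/
def cirmNum (P : Fin M → Measure (E d × ℝ)) : E d :=
  (M : ℝ)⁻¹ • ∑ j, ∫ z, (z.2 - ∫ w, w.2 ∂P j) • z.1 ∂P j

/-- The average over the sources of `E[(Xᵀβ - E[Xᵀβ]) (Y - E Y)]`, the inner means being those of
the same source. -/
def cirmDen (P : Fin M → Measure (E d × ℝ)) (β : E d) : ℝ :=
  (M : ℝ)⁻¹ * ∑ j, ∫ z, (inner ℝ β z.1 - ∫ w, inner ℝ β w.1 ∂P j) * (z.2 - ∫ w, w.2 ∂P j) ∂P j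

/-- The vector `ϑ` of CIRM, for the CIP coefficient `β`. -/
def cirmTheta (P : Fin M → Measure (E d × ℝ)) (β : E d) : E d := (cirmDen P β)⁻¹ • cirmNum P

/-- The matching constraint of CIRM between the laws `P` and `Q`, for the CIP coefficient `βc` and
the vector `θ`. -/
def CIRMMatch (P Q : Measure (E d × ℝ)) (βc θ β : E d) : Prop :=
  ∫ z, inner ℝ β (z.1 - (inner ℝ z.1 βc : ℝ) • θ) ∂P =
    ∫ z, inner ℝ β (z.1 - (inner ℝ z.1 βc : ℝ) • θ) ∂Q

/-- `p` is the CIRM-mean estimator built on the `m`-th source, for the source laws `P` and the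
target law `Pt`. The denominator of `ϑ` is required not to vanish, so that `ϑ` makes sense. -/
def IsCIRM [NeZero M] (P : Fin M → Measure (E d × ℝ)) (Pt : Measure (E d × ℝ)) (m : Fin M)
    (p : E d × ℝ) : Prop :=
  ∃ c : E d × ℝ, IsCIP P c ∧ cirmDen P c.1 ≠ 0 ∧
    CIRMMatch (P m) Pt c.1 (cirmTheta P c.1) p.1 ∧
    ∀ q : E d × ℝ, CIRMMatch (P m) Pt c.1 (cirmTheta P c.1) q.1 →
      risk (P m) (affine p) ≤ risk (P m) (affine q)

/-- `span(a_X^(2) - a_X^(1), …, a_X^(M) - a_X^(1))`. -/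
def interSpan [NeZero M] (aX : Fin M → E d) : Submodule ℝ (E d) :=
  Submodule.span ℝ (Set.range fun m => aX m - aX 0)

/-- The mean of the label interventions of the sources. -/
def meanY (aY : Fin M → ℝ) : ℝ := (∑ m, aY m) / M

/-- The variance `Δ_Y` of the label interventions of the sources. -/
def deltaY (aY : Fin M → ℝ) : ℝ := (∑ m, (aY m - meanY aY) ^ 2) / M

/-- `(ã_Y - ā_Y)² - Δ_Y`. -/
def excessY (aY : Fin M → ℝ) (aYt : ℝ) : ℝ := (aYt - meanY aY) ^ 2 - deltaY aY

/-- The unit vector `v / ‖v‖`; it is `0` if `v = 0`. -/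
def unit (v : E d) : E d := ‖v‖⁻¹ • v

/-- The denominator `1 + ρ (1 + Δ / σ²) κ`. -/
def cipDen (σ ρ Δ κ : ℝ) : ℝ := 1 + ρ * (1 + Δ / σ ^ 2) * κ

end

end AnticausalDA

/-!
All laws are pushed forward from the noise, and `Xᵀβ` depends on `β` only through the pulled back
coefficient `γ = Aᵀβ` with `A = (I - B)⁻¹`. Put `s = γᵀb`. The risk of `(β, β₀)` in an environment is
`σ² (1 - s)² + (σ² / ρ) ‖γ‖²` plus the square of the error of the intercept
(`SCM.IsAnticausal.risk_law`), and every estimator minimizes such an objective over a linear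
subspace for `γ`: the whole space for OLSTar, `Vᗮ` for CIP (`cip_constraint_iff`), and the orthogonal
complement of the covariate shift for CIRM (`cirmMatch_iff`). For CIP the constraint comes from
`E[Xᵀβ | Y]` being affine in `Y` with an intercept that depends on the source: if labels are not
mutually singular, two parallel lines with a common function of the label coincide. Averaging over
the sources replaces `σ²` by `σ² + Δ_Y` in front of `(1 - s)²`. Completing the square
(`exists_unique_minimizer`) gives one minimizer, a multiple of the projection of `b`, and its risk
in the target environment follows by substitution.

For Gaussian interventions the risks depend on the interventions only through the share of `b` in
two random subspaces, `V` and the line of the covariate shift. The laws of both are invariant under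
rotations, so that the share of the fixed vector `b` has the law of the share of an independent
Gaussian vector in the subspace (`measure_share_mem_le`). For a fixed subspace of dimension `k` this
is a ratio of chi-square variables, and Chernoff's bound in the form of Dasgupta and Gupta gives
`exp (k / 2 * (1 - β + log β))` for a deviation by the factor `β` (`stdGaussian_share_le`), used with
`β = 3` and `β = 1 / 3` for `V` and `β = t` for the line. The line depends on `V`, so that the product
of the two probabilities cannot come from independence. It comes from the union bound: each of the
failure probabilities is at most half of its nominal value, and
`1 - (q₁ + q₂) / 2 ≥ (1 - q₁) (1 - q₂)` on the unit square.
-/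

namespace AnticausalDA

/-! ### Penalized least squares over a subspace -/

section Optimization

variable {d : ℕ}

/-- Completing the square: the quadratic objective on `U` around its minimizer
`(A / (C + A‖w‖²)) w`, where `w` is the projection of `b` onto `U`. -/
theorem quadratic_eq_of_mem (U : Submodule ℝ (E d)) (b : E d) {A C : ℝ} (hA : 0 < A) (hC : 0 < C)
    {γ : E d} (hγ : γ ∈ U) :
    A * (1 - inner ℝ γ b) ^ 2 + C * ‖γ‖ ^ 2
      = A * C / (C + A * ‖U.starProjection b‖ ^ 2)
        + A * (inner ℝ γ b - A * ‖U.starProjection b‖ ^ 2 / (C + A * ‖U.starProjection b‖ ^ 2)) ^ 2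
        + C * ‖γ - (A / (C + A * ‖U.starProjection b‖ ^ 2)) • U.starProjection b‖ ^ 2 := by
  set w := U.starProjection b with hw
  have hin : inner ℝ γ b = inner ℝ γ w := by
    rw [hw, ← Submodule.inner_starProjection_left_eq_right,
      Submodule.starProjection_eq_self_iff.2 hγ]
  have hD : C + A * ‖w‖ ^ 2 ≠ 0 := by positivity
  rw [norm_sub_sq_real, inner_smul_right, norm_smul, mul_pow, Real.norm_eq_abs, sq_abs, hin]
  field_simp
  ring

/-- The estimator problem in abstract form. If the constraint says that the transformed
coefficient `T β` lies in `U`, and the objective is `A(1 - ⟪Tβ, b⟫)² + C‖Tβ‖²` plus the square of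
the intercept error, then the minimizer is unique; its coefficient is a multiple of the projection
of `b` onto `U`. -/
theorem exists_unique_minimizer (U : Submodule ℝ (E d)) (b : E d) {A C : ℝ} (hA : 0 < A)
    (hC : 0 < C) (T : E d → E d) (hT : Function.Bijective T) (con : E d → Prop)
    (hcon : ∀ β, con β ↔ T β ∈ U) (ℓ : E d → ℝ) (R : E d × ℝ → ℝ)
    (hR : ∀ p : E d × ℝ, con p.1 →
      R p = A * (1 - inner ℝ (T p.1) b) ^ 2 + C * ‖T p.1‖ ^ 2 + (p.2 - ℓ (T p.1)) ^ 2) :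
    ∃ p : E d × ℝ,
      T p.1 = (A / (C + A * ‖U.starProjection b‖ ^ 2)) • U.starProjection b ∧
      p.2 = ℓ (T p.1) ∧
      ∀ q : E d × ℝ, (con q.1 ∧ ∀ r : E d × ℝ, con r.1 → R q ≤ R r) ↔ q = p := by
  set w := U.starProjection b with hw
  set D := C + A * ‖w‖ ^ 2 with hD
  have hDpos : 0 < D := by positivity
  obtain ⟨β, hβ⟩ := hT.2 ((A / D) • w)
  have hmem : T β ∈ U := by
    rw [hβ]; exact U.smul_mem _ (Submodule.starProjection_apply_mem U b)
  have hwb : inner ℝ w b = ‖w‖ ^ 2 := by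
    rw [hw, ← real_inner_self_eq_norm_sq, ← Submodule.inner_starProjection_left_eq_right,
      Submodule.starProjection_eq_self_iff.2 (Submodule.starProjection_apply_mem U b)]
  have hform : ∀ q : E d × ℝ, con q.1 → R q = A * C / D
      + A * (inner ℝ (T q.1) b - A * ‖w‖ ^ 2 / D) ^ 2 + C * ‖T q.1 - (A / D) • w‖ ^ 2
      + (q.2 - ℓ (T q.1)) ^ 2 := by
    intro q hq
    rw [hR q hq, quadratic_eq_of_mem U b hA hC ((hcon _).1 hq)]
  have hmin : R (β, ℓ (T β)) = A * C / D := by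
    rw [hform _ ((hcon _).2 hmem)]
    simp only [hβ, inner_smul_left, hwb, sub_self, norm_zero]
    simp [mul_div_assoc, div_mul_eq_mul_div]
  refine ⟨(β, ℓ (T β)), hβ, rfl, fun q => ⟨fun h => ?_, ?_⟩⟩
  · have h1 := h.2 (β, ℓ (T β)) ((hcon _).2 hmem)
    rw [hmin, hform q h.1] at h1
    have h2 : 0 ≤ A * (inner ℝ (T q.1) b - A * ‖w‖ ^ 2 / D) ^ 2 := by positivity
    have h3 : 0 ≤ C * ‖T q.1 - (A / D) • w‖ ^ 2 := by positivity
    have h4 := sq_nonneg (q.2 - ℓ (T q.1))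
    have h5 : C * ‖T q.1 - (A / D) • w‖ ^ 2 = 0 := by linarith
    have h6 : (q.2 - ℓ (T q.1)) ^ 2 = 0 := by linarith
    have h7 : T q.1 = T β := by
      rw [hβ]
      have := (mul_eq_zero.1 h5).resolve_left hC.ne'
      exact sub_eq_zero.1 (norm_eq_zero.1 (pow_eq_zero_iff two_ne_zero |>.1 this))
    have h8 : q.2 = ℓ (T β) := by
      rw [← h7]; exact sub_eq_zero.1 (pow_eq_zero_iff two_ne_zero |>.1 h6)
    exact Prod.ext (hT.1 h7) h8
  · rintro rfl
    refine ⟨(hcon _).2 hmem, fun r hr => ?_⟩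
    rw [hmin, hform r hr]
    have h2 : 0 ≤ A * (inner ℝ (T r.1) b - A * ‖w‖ ^ 2 / D) ^ 2 := by positivity
    have h3 : 0 ≤ C * ‖T r.1 - (A / D) • w‖ ^ 2 := by positivity
    have h4 := sq_nonneg (r.2 - ℓ (T r.1))
    linarith

theorem inner_smul_starProjection (U : Submodule ℝ (E d)) (b : E d) (c : ℝ) :
    inner ℝ (c • U.starProjection b) b = c * ‖U.starProjection b‖ ^ 2 := by
  rw [inner_smul_left, ← real_inner_self_eq_norm_sq,
    ← Submodule.inner_starProjection_left_eq_right,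
    Submodule.starProjection_eq_self_iff.2 (Submodule.starProjection_apply_mem U b)]
  rfl

theorem norm_starProjection_orthogonal_sq (U : Submodule ℝ (E d)) (b : E d) :
    ‖Uᗮ.starProjection b‖ ^ 2 = ‖b‖ ^ 2 - ‖U.starProjection b‖ ^ 2 := by
  rw [Submodule.norm_sq_eq_add_norm_sq_starProjection b U]; ring

theorem norm_starProjection_span_singleton_sq (v b : E d) :
    ‖(Submodule.span ℝ {v}).starProjection b‖ ^ 2 = (inner ℝ (unit v) b : ℝ) ^ 2 := by
  rcases eq_or_ne v 0 with rfl | hv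
  · simp [unit]
  · have hn : ‖v‖ ≠ 0 := norm_ne_zero_iff.2 hv
    rw [Submodule.starProjection_singleton, unit, inner_smul_left, norm_smul]
    simp only [RCLike.ofReal_real_eq_id, id, Real.norm_eq_abs, mul_pow, sq_abs, conj_trivial]
    field_simp

end Optimization

/-! ### Moments of an environment -/

namespace SCM

variable {d : ℕ}

/-- The linear map `A = (I - B)⁻¹` that turns the exogenous part `Y b + a_X + ε_X` into `X`. -/
noncomputable def solve (S : SCM d) : E d →ₗ[ℝ] E d := Matrix.toEuclideanLin ((1 - S.B)⁻¹)

/-- The coefficient `Aᵀβ`, for which `Xᵀβ = (Y b + a_X + ε_X)ᵀ(Aᵀβ)`. -/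
noncomputable def pull (S : SCM d) : E d →ₗ[ℝ] E d := LinearMap.adjoint S.solve

theorem inner_solve (S : SCM d) (β w : E d) : inner ℝ β (S.solve w) = inner ℝ (S.pull β) w := by
  rw [pull, LinearMap.adjoint_inner_left]

theorem pull_bijective (S : SCM d) (h : IsUnit (1 - S.B)) : Function.Bijective S.pull := by
  have hdet : IsUnit (1 - S.B).det := (Matrix.isUnit_iff_isUnit_det _).1 h
  have hinj : Function.Injective S.pull := by
    rw [← LinearMap.ker_eq_bot, LinearMap.ker_eq_bot']
    intro β hβ
    refine ext_inner_right ℝ fun v => ?_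
    have hv : S.solve (Matrix.toEuclideanLin (1 - S.B) v) = v := by
      have hm : ∀ A C : Matrix (Fin d) (Fin d) ℝ,
          Matrix.toEuclideanLin A (Matrix.toEuclideanLin C v) = Matrix.toEuclideanLin (A * C) v := by
        intro A C
        ext i
        simp [Matrix.toLpLin_apply, Matrix.mulVec_mulVec]
      rw [solve, hm, Matrix.nonsing_inv_mul _ hdet]
      ext i
      simp
    rw [← hv, inner_solve, hβ]
    simp
  exact ⟨hinj, LinearMap.injective_iff_surjective.1 hinj⟩

theorem inner_X (S : SCM d) (aX : E d) (aY : ℝ) (e : E d × ℝ) (β : E d) :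
    inner ℝ β (S.X aX aY e) =
      Y aY e * inner ℝ (S.pull β) S.b + inner ℝ (S.pull β) aX + inner ℝ (S.pull β) e.1 := by
  change inner ℝ β (S.solve _) = _
  rw [inner_solve, inner_add_right, inner_add_right, inner_smul_right]

theorem measurable_XY (S : SCM d) (aX : E d) (aY : ℝ) :
    Measurable fun e : E d × ℝ => (S.X aX aY e, Y aY e) := by
  have : Continuous (Matrix.toEuclideanLin ((1 - S.B)⁻¹)) :=
    LinearMap.continuous_of_finiteDimensional _
  unfold X Y
  fun_prop

namespace IsAnticausal

variable {S : SCM d} {σ v : ℝ}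

section

variable (hS : S.IsAnticausal σ (v • (1 : Matrix (Fin d) (Fin d) ℝ)))
include hS

theorem memLp_inner (γ : E d) : MemLp (fun e : E d × ℝ => (inner ℝ γ e.1 : ℝ)) 2 S.noise :=
  hS.memLp_X.const_inner γ

theorem integrable_fst : Integrable (fun e : E d × ℝ => e.1) S.noise :=
  have := hS.isProb
  hS.memLp_X.integrable one_le_two

theorem integrable_snd : Integrable (fun e : E d × ℝ => e.2) S.noise :=
  have := hS.isProb
  hS.memLp_Y.integrable one_le_two

theorem integrable_inner (γ : E d) : Integrable (fun e : E d × ℝ => (inner ℝ γ e.1 : ℝ)) S.noise :=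
  hS.integrable_fst.const_inner γ

theorem integral_inner_fst (γ : E d) : ∫ e, (inner ℝ γ e.1 : ℝ) ∂S.noise = 0 := by
  rw [integral_inner hS.integrable_fst, hS.mean_X, inner_zero_right]

theorem integrable_snd_smul : Integrable (fun e : E d × ℝ => e.2 • e.1) S.noise :=
  have := hS.isProb
  hS.memLp_X.smul (p := 2) (q := 2) (r := 1) hS.memLp_Y |>.integrable le_rfl

theorem integral_snd_mul_inner (γ : E d) : ∫ e, e.2 * (inner ℝ γ e.1 : ℝ) ∂S.noise = 0 := by
  have : ∀ e : E d × ℝ, e.2 * (inner ℝ γ e.1 : ℝ) = inner ℝ γ (e.2 • e.1) := fun e => by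
    rw [inner_smul_right]
  simp_rw [this]
  rw [integral_inner hS.integrable_snd_smul, hS.uncorrelated, inner_zero_right]

theorem integral_inner_sq (γ : E d) :
    ∫ e, (inner ℝ γ e.1 : ℝ) ^ 2 ∂S.noise = v * ‖γ‖ ^ 2 := by
  have hco : ∀ i, MemLp (fun e : E d × ℝ => e.1 i) 2 S.noise := fun i => by
    simpa [PiLp.inner_apply] using hS.memLp_inner (EuclideanSpace.single i 1)
  have hint : ∀ i j, Integrable (fun e : E d × ℝ => e.1 i * e.1 j) S.noise := fun i j =>
    (hco i).integrable_mul (hco j)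
  have : ∀ e : E d × ℝ, (inner ℝ γ e.1 : ℝ) ^ 2
      = ∑ i, ∑ j, (γ i * γ j) * (e.1 i * e.1 j) := fun e => by
    rw [pow_two, PiLp.inner_apply, Finset.sum_mul_sum]
    refine Finset.sum_congr rfl fun i _ => Finset.sum_congr rfl fun j _ => ?_
    simp; ring
  simp_rw [this]
  rw [integral_finsetSum _ fun i _ => integrable_finsetSum _ fun j _ => (hint i j).const_mul _]
  simp_rw [integral_finsetSum Finset.univ fun j _ => (hint _ j).const_mul _,
    integral_const_mul, hS.cov_X]
  simp [Matrix.one_apply, EuclideanSpace.real_norm_sq_eq, Finset.mul_sum]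
  refine Finset.sum_congr rfl fun i _ => ?_
  ring

/-- The second moment of an affine function of the noise. -/
theorem integral_affine_noise_sq (γ : E d) (s c : ℝ) :
    ∫ e, (s * e.2 + inner ℝ γ e.1 + c) ^ 2 ∂S.noise = σ ^ 2 * s ^ 2 + v * ‖γ‖ ^ 2 + c ^ 2 := by
  have := hS.isProb
  have h1 : Integrable (fun e : E d × ℝ => e.2 ^ 2) S.noise := hS.memLp_Y.integrable_sq
  have h2 : Integrable (fun e : E d × ℝ => (inner ℝ γ e.1 : ℝ) ^ 2) S.noise :=
    (hS.memLp_inner γ).integrable_sq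
  have h3 : Integrable (fun e : E d × ℝ => e.2 * (inner ℝ γ e.1 : ℝ)) S.noise :=
    hS.memLp_Y.integrable_mul (hS.memLp_inner γ)
  have h4 := hS.integrable_snd
  have h5 := hS.integrable_inner γ
  have : ∀ e : E d × ℝ, (s * e.2 + inner ℝ γ e.1 + c) ^ 2 = s ^ 2 * e.2 ^ 2
      + (inner ℝ γ e.1) ^ 2 + (2 * s) * (e.2 * inner ℝ γ e.1) + (2 * s * c) * e.2
      + (2 * c) * inner ℝ γ e.1 + c ^ 2 := fun e => by ring
  simp_rw [this]
  rw [integral_add (by fun_prop) (by fun_prop), integral_add (by fun_prop) (by fun_prop),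
    integral_add (by fun_prop) (by fun_prop), integral_add (by fun_prop) (by fun_prop),
    integral_add (by fun_prop) (by fun_prop)]
  simp only [integral_const_mul, hS.var_Y, hS.integral_inner_sq, hS.integral_snd_mul_inner,
    hS.mean_Y, hS.integral_inner_fst, integral_const, probReal_univ, smul_eq_mul]
  ring

/-- The risk of an affine predictor, in terms of the pulled back coefficient. -/
theorem risk_law (aX : E d) (aY : ℝ) (p : E d × ℝ) :
    risk (S.law aX aY) (affine p) =
      σ ^ 2 * (1 - inner ℝ (S.pull p.1) S.b) ^ 2 + v * ‖S.pull p.1‖ ^ 2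
        + (p.2 - ((1 - inner ℝ (S.pull p.1) S.b) * aY - inner ℝ (S.pull p.1) aX)) ^ 2 := by
  have hm : Measurable fun z : E d × ℝ => (affine p z.1 - z.2) ^ 2 := by
    unfold affine; fun_prop
  rw [risk, law, integral_map (S.measurable_XY aX aY).aemeasurable hm.aestronglyMeasurable]
  have : ∀ e : E d × ℝ, (affine p (S.X aX aY e) - Y aY e) ^ 2 =
      ((inner ℝ (S.pull p.1) S.b - 1) * e.2 + inner ℝ (S.pull p.1) e.1
        + (p.2 - ((1 - inner ℝ (S.pull p.1) S.b) * aY - inner ℝ (S.pull p.1) aX))) ^ 2 := by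
    intro e
    rw [affine, inner_X, Y]; ring
  simp_rw [this]
  rw [hS.integral_affine_noise_sq]
  ring

theorem isProbabilityMeasure_law (aX : E d) (aY : ℝ) : IsProbabilityMeasure (S.law aX aY) :=
  have := hS.isProb
  Measure.isProbabilityMeasure_map (S.measurable_XY aX aY).aemeasurable

theorem integral_snd_law (aX : E d) (aY : ℝ) : ∫ z, z.2 ∂S.law aX aY = aY := by
  have := hS.isProb
  rw [law, integral_map (S.measurable_XY aX aY).aemeasurable measurable_snd.aestronglyMeasurable]
  simp only [Y]
  rw [integral_add (integrable_const _) hS.integrable_snd, hS.mean_Y]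
  simp

theorem integrable_inner_X (aX : E d) (aY : ℝ) (β : E d) :
    Integrable (fun e => (inner ℝ β (S.X aX aY e) : ℝ)) S.noise := by
  have := hS.isProb
  have h4 := hS.integrable_snd
  have h5 := hS.integrable_inner (S.pull β)
  simp_rw [inner_X, Y]
  fun_prop

theorem integral_inner_law (aX : E d) (aY : ℝ) (β : E d) :
    ∫ z, (inner ℝ β z.1 : ℝ) ∂S.law aX aY
      = aY * inner ℝ (S.pull β) S.b + inner ℝ (S.pull β) aX := by
  have := hS.isProb
  have h4 := hS.integrable_snd
  have h5 := hS.integrable_inner (S.pull β)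
  rw [law, integral_map (S.measurable_XY aX aY).aemeasurable
    (Measurable.aestronglyMeasurable (by fun_prop))]
  have : ∀ e : E d × ℝ, inner ℝ β (S.X aX aY e) = inner ℝ (S.pull β) S.b * e.2
      + inner ℝ (S.pull β) e.1 + (aY * inner ℝ (S.pull β) S.b + inner ℝ (S.pull β) aX) := by
    intro e; rw [inner_X, Y]; ring
  simp_rw [this]
  rw [integral_add (by fun_prop) (by fun_prop), integral_add (by fun_prop) (by fun_prop),
    integral_const_mul, hS.mean_Y, hS.integral_inner_fst]
  simp

theorem integrable_inner_law (aX : E d) (aY : ℝ) (β : E d) :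
    Integrable (fun z : E d × ℝ => (inner ℝ β z.1 : ℝ)) (S.law aX aY) := by
  rw [law, integrable_map_measure (Measurable.aestronglyMeasurable (by fun_prop))
    (S.measurable_XY aX aY).aemeasurable]
  exact hS.integrable_inner_X aX aY β

theorem integral_cov_law (aX : E d) (aY : ℝ) (β : E d) (c : ℝ) :
    ∫ z, ((inner ℝ β z.1 : ℝ) - c) * (z.2 - aY) ∂S.law aX aY
      = σ ^ 2 * inner ℝ (S.pull β) S.b := by
  have := hS.isProb
  have h1 : Integrable (fun e : E d × ℝ => e.2 ^ 2) S.noise := hS.memLp_Y.integrable_sq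
  have h3 : Integrable (fun e : E d × ℝ => e.2 * (inner ℝ (S.pull β) e.1 : ℝ)) S.noise :=
    hS.memLp_Y.integrable_mul (hS.memLp_inner _)
  have h4 := hS.integrable_snd
  rw [law, integral_map (S.measurable_XY aX aY).aemeasurable
    (Measurable.aestronglyMeasurable (by fun_prop))]
  have : ∀ e : E d × ℝ, ((inner ℝ β (S.X aX aY e) : ℝ) - c) * (Y aY e - aY)
      = inner ℝ (S.pull β) S.b * e.2 ^ 2 + e.2 * inner ℝ (S.pull β) e.1
        + (aY * inner ℝ (S.pull β) S.b + inner ℝ (S.pull β) aX - c) * e.2 := by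
    intro e; rw [inner_X, Y]; ring
  simp_rw [this]
  rw [integral_add (by fun_prop) (by fun_prop), integral_add (by fun_prop) (by fun_prop),
    integral_const_mul, integral_const_mul, hS.var_Y, hS.mean_Y, hS.integral_snd_mul_inner]
  ring

theorem integral_smul_law (aX : E d) (aY : ℝ) :
    ∫ z, (z.2 - aY) • z.1 ∂S.law aX aY = S.solve (σ ^ 2 • S.b) := by
  have := hS.isProb
  have hint : Integrable (fun z : E d × ℝ => (z.2 - aY) • z.1) (S.law aX aY) := by
    rw [law, integrable_map_measure (Measurable.aestronglyMeasurable (by fun_prop))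
      (S.measurable_XY aX aY).aemeasurable]
    have h2 : MemLp (fun e : E d × ℝ => Y aY e • S.b + aX + e.1) 2 S.noise := by
      have h1 : MemLp (fun e : E d × ℝ => aY + e.2) 2 S.noise := (memLp_const aY).add hS.memLp_Y
      exact ((((ContinuousLinearMap.toSpanSingleton ℝ S.b).comp_memLp' h1).add
        (memLp_const aX)).add hS.memLp_X)
    have h3 : MemLp (fun e => S.X aX aY e) 2 S.noise :=
      (LinearMap.toContinuousLinearMap S.solve).comp_memLp' h2
    have h4 : MemLp (fun e : E d × ℝ => Y aY e - aY) 2 S.noise := by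
      simpa [Y] using hS.memLp_Y
    exact (h3.smul (p := 2) (q := 2) (r := 1) h4).integrable le_rfl
  refine ext_inner_left ℝ fun β => ?_
  rw [← integral_inner hint, inner_solve, inner_smul_right, ← hS.integral_cov_law aX aY β 0]
  refine integral_congr_ae (.of_forall fun z => ?_)
  simp only [inner_smul_right]; ring

end

end IsAnticausal

end SCM

/-! ### The constraints of CIP and CIRM -/

theorem mem_interSpan_orthogonal_iff {d M : ℕ} [NeZero M] (aX : Fin M → E d) (γ : E d) :
    γ ∈ (interSpan aX)ᗮ ↔ ∀ m, (inner ℝ γ (aX m) : ℝ) = inner ℝ γ (aX 0) := by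
  rw [interSpan, Submodule.mem_orthogonal]
  constructor
  · intro h m
    have := h _ (Submodule.subset_span ⟨m, rfl⟩)
    rw [real_inner_comm, inner_sub_right, sub_eq_zero] at this
    exact this
  · intro h u hu
    induction hu using Submodule.span_induction with
    | mem x hx =>
      obtain ⟨m, rfl⟩ := hx
      rw [real_inner_comm, inner_sub_right, h m, sub_self]
    | zero => simp
    | add x y _ _ hx hy => rw [inner_add_left, hx, hy, add_zero]
    | smul c x _ hx => rw [inner_smul_left, hx, mul_zero]

namespace SCM.IsAnticausal

variable {d : ℕ} {S : SCM d} {σ v : ℝ}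

section

variable (hS : S.IsAnticausal σ (v • (1 : Matrix (Fin d) (Fin d) ℝ)))
include hS

theorem setIntegral_inner_noise (γ : E d) {D : Set ℝ} (hD : MeasurableSet D) :
    ∫ e in Prod.snd ⁻¹' D, (inner ℝ γ e.1 : ℝ) ∂S.noise = 0 := by
  have := hS.isProb
  have hm : MeasurableSpace.comap Prod.snd inferInstance ≤
      (inferInstance : MeasurableSpace (E d × ℝ)) := measurable_snd.comap_le
  rw [integral_inner hS.integrable_fst.integrableOn,
    ← setIntegral_condExp hm hS.integrable_fst ⟨D, hD, rfl⟩,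
    integral_congr_ae (ae_restrict_of_ae hS.condMean)]
  simp

/-- `E[Xᵀβ | Y]` is the affine function of the label with slope `bᵀAᵀβ` and
intercept `a_Xᵀ Aᵀβ`. -/
theorem condExp_law (aX : E d) (aY : ℝ) (β : E d) :
    (S.law aX aY)[fun z => inner ℝ β z.1 | MeasurableSpace.comap Prod.snd inferInstance]
      =ᵐ[S.law aX aY]
        fun z => z.2 * inner ℝ (S.pull β) S.b + inner ℝ (S.pull β) aX := by
  have := hS.isProb
  have := hS.isProbabilityMeasure_law aX aY
  have hm : MeasurableSpace.comap Prod.snd inferInstance ≤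
      (inferInstance : MeasurableSpace (E d × ℝ)) := measurable_snd.comap_le
  have hF := S.measurable_XY aX aY
  have hg : Measurable fun z : E d × ℝ =>
      z.2 * inner ℝ (S.pull β) S.b + inner ℝ (S.pull β) aX := by fun_prop
  have hsnd := hS.integrable_snd
  have hgN : Integrable (fun e : E d × ℝ =>
      Y aY e * inner ℝ (S.pull β) S.b + inner ℝ (S.pull β) aX) S.noise := by
    unfold Y; fun_prop
  have hgi : Integrable (fun z : E d × ℝ =>
      z.2 * inner ℝ (S.pull β) S.b + inner ℝ (S.pull β) aX) (S.law aX aY) := by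
    rw [law, integrable_map_measure hg.aestronglyMeasurable hF.aemeasurable]
    exact hgN
  refine (ae_eq_condExp_of_forall_setIntegral_eq hm (hS.integrable_inner_law aX aY β)
    (fun _ _ _ => hgi.integrableOn) ?_ ?_).symm
  · rintro _ ⟨D, hD, rfl⟩ -
    have hset : (fun e : E d × ℝ => (S.X aX aY e, Y aY e)) ⁻¹' (Prod.snd ⁻¹' D)
        = Prod.snd ⁻¹' ((fun y => aY + y) ⁻¹' D) := rfl
    have hD' : MeasurableSet ((fun y => aY + y) ⁻¹' D) := measurable_const_add aY hD
    rw [law, setIntegral_map (measurable_snd hD) hg.aestronglyMeasurable hF.aemeasurable,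
      setIntegral_map (measurable_snd hD) (Measurable.aestronglyMeasurable (by fun_prop))
        hF.aemeasurable, hset]
    simp only [inner_X]
    rw [integral_add hgN.integrableOn (hS.integrable_inner _).integrableOn,
      hS.setIntegral_inner_noise _ hD', add_zero]
  · refine Measurable.aestronglyMeasurable ?_
    exact (((comap_measurable (Prod.snd : E d × ℝ → ℝ)).mul_const _).add_const _)

/-- Two environments with labels that are not mutually singular have a common regression function
of `Xᵀβ` on the label iff their covariate interventions agree in the direction `Aᵀβ`: otherwise
the labels live on the disjoint sets where the regression function is one or the other of two
parallel lines. -/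
theorem condMeanEq_iff {aX aX' : E d} {aY aY' : ℝ}
    (hY : ¬ (S.labelLaw aY ⟂ₘ S.labelLaw aY')) (β : E d) :
    CondMeanEq (S.law aX aY) (S.law aX' aY') β
      ↔ (inner ℝ (S.pull β) aX : ℝ) = inner ℝ (S.pull β) aX' := by
  constructor
  · rintro ⟨φ, hφ, h1, h2⟩
    by_contra hne
    have key : ∀ (x : E d) (y : ℝ),
        (S.law x y)[fun z => inner ℝ β z.1 | MeasurableSpace.comap Prod.snd inferInstance]
          =ᵐ[S.law x y] (fun z => φ z.2) →
        S.labelLaw y {u | φ u = u * inner ℝ (S.pull β) S.b + inner ℝ (S.pull β) x}ᶜ = 0 := by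
      intro x y h
      have h3 := h.symm.trans (hS.condExp_law x y β)
      have hms : MeasurableSet
          {u | φ u = u * inner ℝ (S.pull β) S.b + inner ℝ (S.pull β) x} :=
        measurableSet_eq_fun hφ (by fun_prop)
      have hYm : Measurable fun e : E d × ℝ => Y y e := by unfold Y; fun_prop
      rw [labelLaw, Measure.map_apply hYm hms.compl]
      have h4 := ae_of_ae_map (S.measurable_XY x y).aemeasurable h3
      exact h4
    refine hY ⟨{u | φ u = u * inner ℝ (S.pull β) S.b + inner ℝ (S.pull β) aX}ᶜ,
      (measurableSet_eq_fun hφ (by fun_prop)).compl, key aX aY h1, ?_⟩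
    refine measure_mono_null ?_ (key aX' aY' h2)
    intro u hu hu'
    simp only [compl_compl, Set.mem_ofPred_eq] at hu hu'
    exact hne (by linarith)
  · intro h
    refine ⟨fun u => u * inner ℝ (S.pull β) S.b + inner ℝ (S.pull β) aX, by fun_prop,
      hS.condExp_law aX aY β, ?_⟩
    rw [h]
    exact hS.condExp_law aX' aY' β

variable {M : ℕ} [NeZero M]

theorem cip_constraint_iff {aX : Fin M → E d} {aY : Fin M → ℝ}
    (hY : ∀ m, ¬ (S.labelLaw (aY m) ⟂ₘ S.labelLaw (aY 0))) (β : E d) :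
    (∀ m, m ≠ 0 → CondMeanEq (S.law (aX m) (aY m)) (S.law (aX 0) (aY 0)) β)
      ↔ S.pull β ∈ (interSpan aX)ᗮ := by
  rw [mem_interSpan_orthogonal_iff]
  constructor
  · intro h m
    rcases eq_or_ne m 0 with rfl | hm
    · rfl
    · exact (hS.condMeanEq_iff (hY m) β).1 (h m hm)
  · intro h m _
    exact (hS.condMeanEq_iff (hY m) β).2 (h m)

/-- On the constraint set, the source average of the risk is a least squares objective whose label
variance is increased by `Δ_Y`. -/
theorem avgRisk_law (aX : Fin M → E d) (aY : Fin M → ℝ) (p : E d × ℝ)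
    (hp : S.pull p.1 ∈ (interSpan aX)ᗮ) :
    avgRisk (fun j => S.law (aX j) (aY j)) (affine p) =
      (σ ^ 2 + deltaY aY) * (1 - inner ℝ (S.pull p.1) S.b) ^ 2 + v * ‖S.pull p.1‖ ^ 2
        + (p.2 - ((1 - inner ℝ (S.pull p.1) S.b) * meanY aY
            - inner ℝ (S.pull p.1) (aX 0))) ^ 2 := by
  rw [mem_interSpan_orthogonal_iff] at hp
  have hM : (M : ℝ) ≠ 0 := Nat.cast_ne_zero.2 (NeZero.ne M)
  simp only [avgRisk, hS.risk_law, hp]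
  set s : ℝ := inner ℝ (S.pull p.1) S.b
  set c : ℝ := inner ℝ (S.pull p.1) (aX 0)
  set w := v * ‖S.pull p.1‖ ^ 2
  set μ := meanY aY with hμ
  have hsum : ∑ m, (aY m - μ) = 0 := by
    rw [Finset.sum_sub_distrib, hμ, meanY]
    simp
    field_simp
    simp
  have hdel : ∑ m, (aY m - μ) ^ 2 = M * deltaY aY := by
    rw [deltaY, ← hμ]; field_simp
  have : ∀ m, σ ^ 2 * (1 - s) ^ 2 + w + (p.2 - ((1 - s) * aY m - c)) ^ 2
      = (σ ^ 2 * (1 - s) ^ 2 + w + (p.2 - ((1 - s) * μ - c)) ^ 2)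
        + (1 - s) ^ 2 * (aY m - μ) ^ 2
        - (2 * (1 - s) * (p.2 - ((1 - s) * μ - c))) * (aY m - μ) := fun m => by ring
  simp_rw [this]
  rw [Finset.sum_sub_distrib, Finset.sum_add_distrib, ← Finset.mul_sum, ← Finset.mul_sum, hsum,
    hdel]
  simp
  field_simp
  ring

theorem cirmDen_law (aX : Fin M → E d) (aY : Fin M → ℝ) (β : E d) :
    cirmDen (fun j => S.law (aX j) (aY j)) β = σ ^ 2 * inner ℝ (S.pull β) S.b := by
  have hM : (M : ℝ) ≠ 0 := Nat.cast_ne_zero.2 (NeZero.ne M)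
  simp only [cirmDen, hS.integral_snd_law, hS.integral_cov_law]
  simp
  field_simp

theorem cirmNum_law (aX : Fin M → E d) (aY : Fin M → ℝ) :
    cirmNum (fun j => S.law (aX j) (aY j)) = S.solve (σ ^ 2 • S.b) := by
  have hM : (M : ℝ) ≠ 0 := Nat.cast_ne_zero.2 (NeZero.ne M)
  simp only [cirmNum, hS.integral_snd_law, hS.integral_smul_law]
  rw [Finset.sum_const, Finset.card_univ, Fintype.card_fin, ← Nat.cast_smul_eq_nsmul ℝ,
    smul_smul, inv_mul_cancel₀ hM, one_smul]

theorem integral_match_law (aX : E d) (aY : ℝ) (βc θ β : E d) :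
    ∫ z, inner ℝ β (z.1 - (inner ℝ z.1 βc : ℝ) • θ) ∂S.law aX aY
      = (aY * inner ℝ (S.pull β) S.b + inner ℝ (S.pull β) aX)
        - (aY * inner ℝ (S.pull βc) S.b + inner ℝ (S.pull βc) aX) * inner ℝ β θ := by
  have : ∀ z : E d × ℝ, (inner ℝ β (z.1 - (inner ℝ z.1 βc : ℝ) • θ) : ℝ)
      = inner ℝ β z.1 - inner ℝ βc z.1 * inner ℝ β θ := fun z => by
    rw [inner_sub_right, inner_smul_right, real_inner_comm βc z.1]
  simp_rw [this]
  rw [integral_sub (hS.integrable_inner_law aX aY β)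
    ((hS.integrable_inner_law aX aY βc).mul_const _), integral_mul_const, hS.integral_inner_law,
    hS.integral_inner_law]

/-- Since the CIP coefficient does not see the covariate shift, subtracting its multiple of `ϑ`
removes exactly the label shift; the matching constraint is orthogonality of `Aᵀβ` to the
covariate shift. -/
theorem cirmMatch_iff (hσ : 0 < σ) (aX : Fin M → E d) (aY : Fin M → ℝ) {aXt : E d} (aYt : ℝ)
    (m : Fin M) {βc : E d} (hden : (inner ℝ (S.pull βc) S.b : ℝ) ≠ 0)
    (hβc : (inner ℝ (S.pull βc) (aX m) : ℝ) = inner ℝ (S.pull βc) aXt) (β : E d) :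
    CIRMMatch (S.law (aX m) (aY m)) (S.law aXt aYt) βc
        (cirmTheta (fun j => S.law (aX j) (aY j)) βc) β
      ↔ S.pull β ∈ (Submodule.span ℝ {aX m - aXt})ᗮ := by
  have hθ : (inner ℝ β (cirmTheta (fun j => S.law (aX j) (aY j)) βc) : ℝ)
      = inner ℝ (S.pull β) S.b / inner ℝ (S.pull βc) S.b := by
    rw [cirmTheta, hS.cirmDen_law, hS.cirmNum_law, inner_smul_right, inner_solve,
      inner_smul_right]
    field_simp
  rw [CIRMMatch, hS.integral_match_law, hS.integral_match_law, hθ, hβc,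
    Submodule.mem_orthogonal_singleton_iff_inner_left, inner_sub_right, sub_eq_zero]
  have h1 : ∀ y : ℝ, (y * inner ℝ (S.pull βc) S.b + inner ℝ (S.pull βc) aXt)
      * (inner ℝ (S.pull β) S.b / inner ℝ (S.pull βc) S.b)
      = y * inner ℝ (S.pull β) S.b
        + inner ℝ (S.pull βc) aXt * (inner ℝ (S.pull β) S.b / inner ℝ (S.pull βc) S.b) := by
    intro y; field_simp
  rw [h1, h1]
  constructor <;> intro h <;> linarith

end

end SCM.IsAnticausal

/-! ### The exact risks -/

theorem deltaY_nonneg {M : ℕ} (aY : Fin M → ℝ) : 0 ≤ deltaY aY := by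
  unfold deltaY; positivity

namespace SCM.IsAnticausal

variable {d : ℕ} {S : SCM d} {σ ρ : ℝ}

section

variable (hS : S.IsAnticausal σ ((σ ^ 2 / ρ) • (1 : Matrix (Fin d) (Fin d) ℝ)))
include hS

/-- The estimator trained on a single environment under the constraint `Aᵀβ ∈ U` is unique, and
its risk in another environment, with a covariate shift orthogonal to `U`. -/
theorem exists_single_source (hσ : 0 < σ) (hρ : 0 < ρ) (U : Submodule ℝ (E d)) (con : E d → Prop)
    (hcon : ∀ β, con β ↔ S.pull β ∈ U) {aX aXt : E d} (aY aYt : ℝ) (hsh : aX - aXt ∈ Uᗮ) :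
    ∃ p₀ : E d × ℝ,
      (∀ q : E d × ℝ, (con q.1 ∧ ∀ r : E d × ℝ, con r.1 →
        risk (S.law aX aY) (affine q) ≤ risk (S.law aX aY) (affine r)) ↔ q = p₀) ∧
      risk (S.law aXt aYt) (affine p₀) = σ ^ 2 / (1 + ρ * ‖U.starProjection S.b‖ ^ 2)
        + (aYt - aY) ^ 2 / (1 + ρ * ‖U.starProjection S.b‖ ^ 2) ^ 2 := by
  obtain ⟨p₀, h1, h2, h3⟩ := exists_unique_minimizer U S.b (A := σ ^ 2) (C := σ ^ 2 / ρ)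
    (by positivity) (by positivity) S.pull (S.pull_bijective hS.invertible) con hcon
    (fun γ => (1 - inner ℝ γ S.b) * aY - inner ℝ γ aX) (fun p => risk (S.law aX aY) (affine p))
    (fun p _ => hS.risk_law aX aY p)
  refine ⟨p₀, h3, ?_⟩
  set w := U.starProjection S.b with hw
  have hk : 0 < 1 + ρ * ‖w‖ ^ 2 := by positivity
  have hc : σ ^ 2 / (σ ^ 2 / ρ + σ ^ 2 * ‖w‖ ^ 2) = ρ / (1 + ρ * ‖w‖ ^ 2) := by
    field_simp
  have horth : (inner ℝ (S.pull p₀.1) aX : ℝ) = inner ℝ (S.pull p₀.1) aXt := by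
    rw [← sub_eq_zero, ← inner_sub_right, h1]
    exact Submodule.inner_right_of_mem_orthogonal
      (U.smul_mem _ (Submodule.starProjection_apply_mem U S.b)) hsh
  rw [hS.risk_law, h2, horth, h1, hc, inner_smul_starProjection, norm_smul, mul_pow,
    Real.norm_eq_abs, sq_abs, ← hw]
  field_simp
  ring

theorem exists_isOLS (hσ : 0 < σ) (hρ : 0 < ρ) (aX : E d) (aY : ℝ) :
    ∃ p₀ : E d × ℝ, (∀ q, IsOLS (S.law aX aY) q ↔ q = p₀) ∧
      risk (S.law aX aY) (affine p₀) = σ ^ 2 / (1 + ρ * ‖S.b‖ ^ 2) := by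
  obtain ⟨p₀, h1, h2⟩ := hS.exists_single_source hσ hρ ⊤ (fun _ => True) (by simp)
    (aX := aX) (aXt := aX) aY aY (by simp)
  refine ⟨p₀, fun q => ?_, ?_⟩
  · rw [← h1]; simp [IsOLS]
  · rw [Submodule.starProjection_eq_self_iff.2 Submodule.mem_top] at h2
    simpa using h2

variable {M : ℕ} [NeZero M]

/-- CIP is unique, its coefficient is a multiple of the projection of `b` onto `Vᗮ`, and its
target risk. -/
theorem exists_isCIP (hσ : 0 < σ) (hρ : 0 < ρ) {aX : Fin M → E d} {aY : Fin M → ℝ}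
    (hY : ∀ m, ¬ (S.labelLaw (aY m) ⟂ₘ S.labelLaw (aY 0))) {aXt : E d} (aYt : ℝ)
    (hsh : aXt - aX 0 ∈ interSpan aX) :
    ∃ p₀ : E d × ℝ,
      (∀ q, IsCIP (fun j => S.law (aX j) (aY j)) q ↔ q = p₀) ∧
      S.pull p₀.1 ∈ (interSpan aX)ᗮ ∧
      ((inner ℝ (S.pull p₀.1) S.b : ℝ) ≠ 0 ↔ S.b ∉ interSpan aX) ∧
      risk (S.law aXt aYt) (affine p₀) =
        (σ ^ 2 + deltaY aY) /
            cipDen σ ρ (deltaY aY) (‖S.b‖ ^ 2 - ‖(interSpan aX).starProjection S.b‖ ^ 2)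
          + excessY aY aYt /
            cipDen σ ρ (deltaY aY)
              (‖S.b‖ ^ 2 - ‖(interSpan aX).starProjection S.b‖ ^ 2) ^ 2 := by
  have hΔ := deltaY_nonneg aY
  obtain ⟨p₀, h1, h2, h3⟩ := exists_unique_minimizer (interSpan aX)ᗮ S.b
    (A := σ ^ 2 + deltaY aY) (C := σ ^ 2 / ρ)
    (by positivity) (by positivity) S.pull (S.pull_bijective hS.invertible) _
    (hS.cip_constraint_iff (aX := aX) hY)
    (fun γ => (1 - inner ℝ γ S.b) * meanY aY - inner ℝ γ (aX 0))
    (fun p => avgRisk (fun j => S.law (aX j) (aY j)) (affine p))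
    (fun p hp => hS.avgRisk_law aX aY p ((hS.cip_constraint_iff hY _).1 hp))
  have hmem : S.pull p₀.1 ∈ (interSpan aX)ᗮ := by
    rw [h1]; exact Submodule.smul_mem _ _ (Submodule.starProjection_apply_mem _ _)
  have horth : (inner ℝ (S.pull p₀.1) aXt : ℝ) = inner ℝ (S.pull p₀.1) (aX 0) := by
    rw [← sub_eq_zero, ← inner_sub_right]
    exact Submodule.inner_left_of_mem_orthogonal hsh hmem
  refine ⟨p₀, h3, hmem, ?_, ?_⟩
  · rw [h1, inner_smul_starProjection, not_iff_not, mul_eq_zero]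
    have : (σ ^ 2 + deltaY aY) / (σ ^ 2 / ρ + (σ ^ 2 + deltaY aY)
        * ‖(interSpan aX)ᗮ.starProjection S.b‖ ^ 2) ≠ 0 := by positivity
    simp only [this, false_or, pow_eq_zero_iff two_ne_zero, norm_eq_zero,
      Submodule.starProjection_apply_eq_zero_iff, Submodule.orthogonal_orthogonal]
  · rw [← norm_starProjection_orthogonal_sq]
    set w := (interSpan aX)ᗮ.starProjection S.b with hw
    have hD : cipDen σ ρ (deltaY aY) (‖w‖ ^ 2)
        = ρ / σ ^ 2 * (σ ^ 2 / ρ + (σ ^ 2 + deltaY aY) * ‖w‖ ^ 2) := by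
      rw [cipDen]; field_simp
    have hpos : 0 < σ ^ 2 / ρ + (σ ^ 2 + deltaY aY) * ‖w‖ ^ 2 := by positivity
    rw [hS.risk_law, h2, horth, h1, inner_smul_starProjection, norm_smul, mul_pow,
      Real.norm_eq_abs, sq_abs, ← hw, hD, excessY]
    set D := σ ^ 2 / ρ + (σ ^ 2 + deltaY aY) * ‖w‖ ^ 2 with hDdef
    have hk : (σ ^ 2 + deltaY aY) * ‖w‖ ^ 2 = D - σ ^ 2 / ρ := by rw [hDdef]; ring
    have h1s : (σ ^ 2 + deltaY aY) / D * ‖w‖ ^ 2 = 1 - σ ^ 2 / ρ / D := by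
      rw [div_mul_eq_mul_div, hk]; field_simp
    have h2s : ((σ ^ 2 + deltaY aY) / D) ^ 2 * ‖w‖ ^ 2
        = (σ ^ 2 + deltaY aY) * (D - σ ^ 2 / ρ) / D ^ 2 := by
      rw [← hk]; field_simp
    rw [h1s, h2s]
    field_simp
    ring

theorem existsUnique_isCIRM_and_risk (hσ : 0 < σ) (hρ : 0 < ρ) {aX : Fin M → E d}
    {aY : Fin M → ℝ} (hY : ∀ m, ¬ (S.labelLaw (aY m) ⟂ₘ S.labelLaw (aY 0))) {aXt : E d} (aYt : ℝ)
    (hsh : aXt - aX 0 ∈ interSpan aX) (m : Fin M) :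
    (S.b ∉ interSpan aX →
      ∃! p, IsCIRM (fun j => S.law (aX j) (aY j)) (S.law aXt aYt) m p) ∧
    ∀ p, IsCIRM (fun j => S.law (aX j) (aY j)) (S.law aXt aYt) m p →
      risk (S.law aXt aYt) (affine p)
        = σ ^ 2 / (1 + ρ * (‖S.b‖ ^ 2 - (inner ℝ (unit (aX m - aXt)) S.b : ℝ) ^ 2))
          + (aYt - aY m) ^ 2 /
            (1 + ρ * (‖S.b‖ ^ 2 - (inner ℝ (unit (aX m - aXt)) S.b : ℝ) ^ 2)) ^ 2 := by
  obtain ⟨c, hc, hcV, hc0, -⟩ := hS.exists_isCIP hσ hρ hY aYt hsh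
  have hcm : (inner ℝ (S.pull c.1) (aX m) : ℝ) = inner ℝ (S.pull c.1) aXt := by
    rw [(mem_interSpan_orthogonal_iff aX _).1 hcV m, eq_comm, ← sub_eq_zero, ← inner_sub_right]
    exact Submodule.inner_left_of_mem_orthogonal hsh hcV
  have hden : cirmDen (fun j => S.law (aX j) (aY j)) c.1 ≠ 0 ↔ S.b ∉ interSpan aX := by
    rw [hS.cirmDen_law, ← hc0]
    simp [hσ.ne']
  have key : S.b ∉ interSpan aX → ∃ p₀ : E d × ℝ,
      (∀ q, IsCIRM (fun j => S.law (aX j) (aY j)) (S.law aXt aYt) m q ↔ q = p₀) ∧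
      risk (S.law aXt aYt) (affine p₀)
        = σ ^ 2 / (1 + ρ * (‖S.b‖ ^ 2 - (inner ℝ (unit (aX m - aXt)) S.b : ℝ) ^ 2))
          + (aYt - aY m) ^ 2 /
            (1 + ρ * (‖S.b‖ ^ 2 - (inner ℝ (unit (aX m - aXt)) S.b : ℝ) ^ 2)) ^ 2 := by
    intro hb
    obtain ⟨p₀, h1, h2⟩ := hS.exists_single_source hσ hρ (Submodule.span ℝ {aX m - aXt})ᗮ
      (CIRMMatch (S.law (aX m) (aY m)) (S.law aXt aYt) c.1
        (cirmTheta (fun j => S.law (aX j) (aY j)) c.1))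
      (hS.cirmMatch_iff hσ aX aY aYt m (hc0.2 hb) hcm) (aX := aX m) (aXt := aXt) (aY m) aYt
      (Submodule.le_orthogonal_orthogonal _ (Submodule.mem_span_singleton_self _))
    refine ⟨p₀, fun q => ?_, ?_⟩
    · rw [← h1 q]
      constructor
      · rintro ⟨c', hc', -, hq⟩
        rwa [(hc c').1 hc'] at hq
      · exact fun hq => ⟨c, (hc c).2 rfl, hden.2 hb, hq⟩
    · rw [h2, norm_starProjection_orthogonal_sq, norm_starProjection_span_singleton_sq]
  refine ⟨fun hb => ?_, fun p hp => ?_⟩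
  · obtain ⟨p₀, h1, -⟩ := key hb
    exact ⟨p₀, (h1 p₀).2 rfl, fun q hq => (h1 q).1 hq⟩
  · obtain ⟨c', hc', hden', -⟩ := id hp
    rw [(hc c').1 hc'] at hden'
    obtain ⟨p₀, h1, h2⟩ := key (hden.1 hden')
    rw [(h1 p).1 hp, h2]

end

end SCM.IsAnticausal

/-! ### Tails of the projection of a Gaussian vector -/

section Chernoff

theorem integral_exp_sq_gaussianReal {a : ℝ} (ha : 0 < a) :
    ∫ x, Real.exp ((1 - a) / 2 * x ^ 2) ∂gaussianReal 0 1 = Real.exp (-(Real.log a) / 2) := by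
  rw [integral_gaussianReal_eq_integral_smul one_ne_zero]
  have h : ∀ x : ℝ, gaussianPDFReal 0 1 x • Real.exp ((1 - a) / 2 * x ^ 2)
      = (√(2 * Real.pi))⁻¹ * Real.exp (-(a / 2) * x ^ 2) := fun x => by
    rw [gaussianPDFReal, smul_eq_mul, mul_assoc, ← Real.exp_add]
    simp only [NNReal.coe_one, mul_one, sub_zero]
    congr 2
    ring
  simp_rw [h]
  rw [integral_const_mul, integral_gaussian, show Real.pi / (a / 2) = 2 * Real.pi / a by field_simp,
    Real.sqrt_div' _ ha.le, neg_div, Real.exp_neg, ← Real.log_sqrt ha.le,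
    Real.exp_log (Real.sqrt_pos.2 ha)]
  have : √(2 * Real.pi) ≠ 0 := by positivity
  field_simp

variable {d : ℕ}

/-- An orthonormal basis adapted to a subspace and its orthogonal complement. -/
theorem exists_adapted_basis (U : Submodule ℝ (E d)) :
    ∃ e : OrthonormalBasis (Fin (Module.finrank ℝ U) ⊕ Fin (d - Module.finrank ℝ U)) ℝ (E d),
      (∀ i, e (.inl i) ∈ U) ∧ ∀ i, e (.inr i) ∈ Uᗮ := by
  have hk : Module.finrank ℝ Uᗮ = d - Module.finrank ℝ U := by
    have := Submodule.finrank_add_finrank_orthogonal U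
    rw [finrank_euclideanSpace_fin] at this
    omega
  let bU := stdOrthonormalBasis ℝ U
  let bV := (stdOrthonormalBasis ℝ Uᗮ).reindex (finCongr hk)
  let f : Fin (Module.finrank ℝ U) ⊕ Fin (d - Module.finrank ℝ U) → E d :=
    Sum.elim (fun i => (bU i : E d)) (fun i => (bV i : E d))
  have hf : Orthonormal ℝ f := by
    constructor
    · rintro (i | i)
      · exact bU.orthonormal.1 i
      · exact bV.orthonormal.1 i
    · rintro (i | i) (j | j) hij
      · have := bU.orthonormal.2 (fun h => hij (congrArg _ h) : i ≠ j)
        simpa [f] using this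
      · exact Submodule.inner_right_of_mem_orthogonal (bU i).2 (bV j).2
      · exact Submodule.inner_left_of_mem_orthogonal (bU j).2 (bV i).2
      · have := bV.orthonormal.2 (fun h => hij (congrArg _ h) : i ≠ j)
        simpa [f] using this
  have hcard : Fintype.card (Fin (Module.finrank ℝ U) ⊕ Fin (d - Module.finrank ℝ U))
      = Module.finrank ℝ (E d) := by
    have := U.finrank_le
    rw [finrank_euclideanSpace_fin] at this
    simp
    omega
  have hspan : ⊤ ≤ Submodule.span ℝ (Set.range f) :=
    (hf.linearIndependent.span_eq_top_of_card_eq_finrank' hcard).ge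
  refine ⟨OrthonormalBasis.mk hf hspan, fun i => ?_, fun i => ?_⟩
  · rw [OrthonormalBasis.coe_mk]; exact (bU i).2
  · rw [OrthonormalBasis.coe_mk]; exact (bV i).2

/-- The moment generating function of the two independent chi-square variables `‖Π_U x‖²` and
`‖x‖² - ‖Π_U x‖²`. -/
theorem integral_exp_starProjection (U : Submodule ℝ (E d)) {a a' : ℝ} (ha : 0 < a)
    (ha' : 0 < a') :
    ∫ x, Real.exp ((1 - a) / 2 * ‖U.starProjection x‖ ^ 2
        + (1 - a') / 2 * (‖x‖ ^ 2 - ‖U.starProjection x‖ ^ 2)) ∂stdGaussian (E d)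
      = Real.exp (-(Module.finrank ℝ U * Real.log a
          + (d - Module.finrank ℝ U) * Real.log a') / 2) := by
  obtain ⟨e, heU, heV⟩ := exists_adapted_basis U
  have hkd : Module.finrank ℝ U ≤ d := by
    simpa using U.finrank_le
  rw [stdGaussian_eq_map_pi_orthonormalBasis e, integral_map (Measurable.aemeasurable (by fun_prop))
    (Measurable.aestronglyMeasurable (by fun_prop))]
  have hin : ∀ (y : Fin (Module.finrank ℝ U) ⊕ Fin (d - Module.finrank ℝ U) → ℝ) i,
      (inner ℝ (e i) (∑ j, y j • e j) : ℝ) = y i := fun y i => by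
    rw [inner_sum]
    simp [inner_smul_right, OrthonormalBasis.inner_eq_ite]
  have hnorm : ∀ y : Fin (Module.finrank ℝ U) ⊕ Fin (d - Module.finrank ℝ U) → ℝ,
      ‖∑ j, y j • e j‖ ^ 2 = ∑ i, y (.inl i) ^ 2 + ∑ i, y (.inr i) ^ 2 := fun y => by
    rw [← e.sum_sq_inner_right, Fintype.sum_sum_type]
    simp only [hin]
  have hproj : ∀ y : Fin (Module.finrank ℝ U) ⊕ Fin (d - Module.finrank ℝ U) → ℝ,
      ‖U.starProjection (∑ j, y j • e j)‖ ^ 2 = ∑ i, y (.inl i) ^ 2 := fun y => by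
    rw [← e.sum_sq_inner_right, Fintype.sum_sum_type]
    simp only [← Submodule.inner_starProjection_left_eq_right,
      Submodule.starProjection_eq_self_iff.2 (heU _),
      (Submodule.starProjection_apply_eq_zero_iff U).2 (heV _), inner_zero_left, hin]
    simp
  let g : Fin (Module.finrank ℝ U) ⊕ Fin (d - Module.finrank ℝ U) → ℝ → ℝ :=
    Sum.elim (fun _ x => Real.exp ((1 - a) / 2 * x ^ 2)) (fun _ x => Real.exp ((1 - a') / 2 * x ^ 2))
  have hprod : ∀ y : Fin (Module.finrank ℝ U) ⊕ Fin (d - Module.finrank ℝ U) → ℝ,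
      Real.exp ((1 - a) / 2 * ‖U.starProjection (∑ j, y j • e j)‖ ^ 2
        + (1 - a') / 2 * (‖∑ j, y j • e j‖ ^ 2 - ‖U.starProjection (∑ j, y j • e j)‖ ^ 2))
      = ∏ i, g i (y i) := fun y => by
    rw [hnorm, hproj, Fintype.prod_sum_type]
    simp only [g, Sum.elim_inl, Sum.elim_inr, ← Real.exp_sum, ← Real.exp_add, Finset.mul_sum]
    simp [Finset.mul_sum]
  simp_rw [hprod]
  rw [integral_fintype_prod_eq_prod, Fintype.prod_sum_type]
  simp only [g, Sum.elim_inl, Sum.elim_inr, integral_exp_sq_gaussianReal ha,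
    integral_exp_sq_gaussianReal ha', Finset.prod_const, Finset.card_univ, Fintype.card_fin,
    ← Real.exp_nat_mul, ← Real.exp_add, Nat.cast_sub hkd]
  congr 1
  ring

/-- The share `‖Π_U x‖² / ‖x‖²` of `x` that lies in the subspace `U`; it is `0` if `x = 0`. -/
noncomputable def share (U : Submodule ℝ (E d)) (x : E d) : ℝ :=
  ‖U.starProjection x‖ ^ 2 / ‖x‖ ^ 2

/-- Chernoff's bound with the exponent of Dasgupta and Gupta, for both tails at once. The exponent
is the linear form of `‖Π_U x‖²` and `‖x‖²` that vanishes when the share is `kβ/d`, with the slope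
that optimizes the bound. -/
theorem stdGaussian_share_le (U : Submodule ℝ (E d)) {β : ℝ} (hβ : 0 < β)
    (hk : Module.finrank ℝ U < d) (hkβ : Module.finrank ℝ U * β < d) (s : Set (E d))
    (hs : ∀ x ∈ s, 0 ≤ (β - 1) * (share U x - Module.finrank ℝ U * β / d)) :
    stdGaussian (E d) s
      ≤ ENNReal.ofReal (Real.exp (Module.finrank ℝ U / 2 * (1 - β + Real.log β))) := by
  set k : ℝ := ((Module.finrank ℝ U : ℕ) : ℝ) with hkdef
  have hk' : k < d := Nat.cast_lt.2 hk
  have hk0 : 0 ≤ k := Nat.cast_nonneg _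
  have hd : (0 : ℝ) < d := hk0.trans_lt hk'
  set a : ℝ := β⁻¹ with ha
  set a' : ℝ := (d - k) / (d - k * β) with ha'
  have hdk : 0 < d - k := sub_pos.2 hk'
  have hdkβ : 0 < d - k * β := sub_pos.2 hkβ
  have hapos : 0 < a := inv_pos.2 hβ
  have ha'pos : 0 < a' := div_pos hdk hdkβ
  have hint := integral_exp_starProjection U hapos ha'pos
  set F : E d → ℝ := fun x => Real.exp ((1 - a) / 2 * ‖U.starProjection x‖ ^ 2
        + (1 - a') / 2 * (‖x‖ ^ 2 - ‖U.starProjection x‖ ^ 2)) with hF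
  have hFint : Integrable F (stdGaussian (E d)) := by
    by_contra h
    rw [integral_undef h] at hint
    exact (Real.exp_pos _).ne hint
  have hsub : s ⊆ {x | 1 ≤ F x} := by
    intro x hx
    change 1 ≤ Real.exp _
    rw [Real.one_le_exp_iff]
    rcases eq_or_ne x 0 with rfl | hx0
    · simp
    have hn : 0 < ‖x‖ ^ 2 := by positivity
    have hp : ‖U.starProjection x‖ ^ 2 = share U x * ‖x‖ ^ 2 := by
      rw [share]; field_simp
    have h := hs x hx
    have hne : (d : ℝ) - k * β ≠ 0 := hdkβ.ne'
    have : (1 - a) / 2 * ‖U.starProjection x‖ ^ 2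
        + (1 - a') / 2 * (‖x‖ ^ 2 - ‖U.starProjection x‖ ^ 2)
        = (d / (2 * β * (d - k * β))) * ‖x‖ ^ 2 * ((β - 1) * (share U x - k * β / d)) := by
      have h1 : 1 - a' = -(k * (β - 1)) / (d - k * β) := by
        rw [ha', eq_div_iff hne, sub_mul, div_mul_cancel₀ _ hne]; ring
      have h2 : 1 - a = (β - 1) / β := by rw [ha]; field_simp
      have h3 : (d / (2 * β * (d - k * β))) * ‖x‖ ^ 2 * ((β - 1) * (share U x - k * β / d))
          = ‖x‖ ^ 2 / (2 * β * (d - k * β)) * ((β - 1) * (d * share U x - k * β)) := by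
        field_simp
      rw [hp, h1, h2, h3]
      generalize hm : (d : ℝ) - k * β = m at hne
      rw [sub_eq_iff_eq_add.1 hm]
      field_simp
      ring
    rw [this]
    positivity
  have hmarkov := mul_meas_ge_le_integral_of_nonneg
    (ae_of_all _ fun x => (Real.exp_pos _).le : 0 ≤ᵐ[stdGaussian (E d)] F) hFint 1
  rw [one_mul, hint] at hmarkov
  have hlog : -(k * Real.log a + (d - k) * Real.log a') / 2 ≤ k / 2 * (1 - β + Real.log β) := by
    have h1 : Real.log a = -Real.log β := by rw [ha, Real.log_inv]
    have h2 : -Real.log a' ≤ (d - k * β) / (d - k) - 1 := by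
      rw [ha', ← Real.log_inv, inv_div]
      exact Real.log_le_sub_one_of_pos (div_pos hdkβ hdk)
    have h3 : (d - k) * -Real.log a' ≤ (d - k) * ((d - k * β) / (d - k) - 1) :=
      mul_le_mul_of_nonneg_left h2 hdk.le
    have h4 : (d - k) * ((d - k * β) / (d - k) - 1) = k * (1 - β) := by
      field_simp; ring
    rw [h1]
    linarith
  refine (measure_mono hsub).trans ?_
  rw [← ofReal_measureReal]
  exact ENNReal.ofReal_le_ofReal (hmarkov.trans (Real.exp_le_exp.2 hlog))

end Chernoff

/-! ### Gaussian vectors and rotations -/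

section Gaussian

variable {d : ℕ}

theorem stdGaussian_submodule {U : Submodule ℝ (E d)} (hU : U ≠ ⊤) :
    stdGaussian (E d) (U : Set (E d)) = 0 := by
  obtain ⟨v, hv, hv0⟩ := Submodule.exists_mem_ne_zero_of_ne_bot
    (mt (Submodule.orthogonal_eq_bot_iff).1 hU)
  have hsub : (U : Set (E d)) ⊆ (innerSL ℝ v) ⁻¹' {0} := fun x hx => by
    simpa using Submodule.inner_left_of_mem_orthogonal hx hv
  refine measure_mono_null hsub ?_
  have hvar : Var[innerSL ℝ v; stdGaussian (E d)] = ‖v‖ ^ 2 := by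
    rw [variance_dual_stdGaussian, innerSL_apply_norm]
  have hne : (‖v‖ ^ 2).toNNReal ≠ 0 := by
    rw [ne_eq, Real.toNNReal_eq_zero, not_le]; positivity
  rw [← Measure.map_apply (by fun_prop) (measurableSet_singleton 0),
    IsGaussian.map_eq_gaussianReal, hvar]
  have := nullSingletonClass_gaussianReal (μ := (stdGaussian (E d))[innerSL ℝ v]) hne
  exact measure_singleton 0

theorem multivariateGaussian_eq_map (τ : ℝ) :
    multivariateGaussian 0 (τ ^ 2 • (1 : Matrix (Fin d) (Fin d) ℝ))
      = (stdGaussian (E d)).map (fun x => τ • x) := by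
  have hS : (τ ^ 2 • (1 : Matrix (Fin d) (Fin d) ℝ)).PosSemidef :=
    Matrix.PosSemidef.one.smul (sq_nonneg τ)
  apply Measure.ext_of_charFun
  ext t
  rw [charFun_map_smul, charFun_multivariateGaussian hS, charFun_stdGaussian]
  congr 1
  have : (t.ofLp ⬝ᵥ (τ ^ 2 • (1 : Matrix (Fin d) (Fin d) ℝ)).mulVec t.ofLp : ℝ) = ‖τ • t‖ ^ 2 := by
    rw [Matrix.smul_mulVec, Matrix.one_mulVec, norm_smul, mul_pow, Real.norm_eq_abs, sq_abs,
      EuclideanSpace.real_norm_sq_eq, dotProduct, Finset.mul_sum]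
    refine Finset.sum_congr rfl fun i _ => ?_
    simp; ring
  rw [this]
  simp
  ring

theorem multivariateGaussian_submodule {τ : ℝ} (hτ : τ ≠ 0) {U : Submodule ℝ (E d)}
    (hU : U ≠ ⊤) :
    multivariateGaussian 0 (τ ^ 2 • (1 : Matrix (Fin d) (Fin d) ℝ)) (U : Set (E d)) = 0 := by
  rw [multivariateGaussian_eq_map, Measure.map_apply (by fun_prop)
    U.closed_of_finiteDimensional.measurableSet]
  have : (fun x : E d => τ • x) ⁻¹' (U : Set (E d)) = U := by
    ext x
    exact U.smul_mem_iff hτ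
  rw [this, stdGaussian_submodule hU]

theorem measurePreserving_multivariateGaussian (τ : ℝ) (f : E d ≃ₗᵢ[ℝ] E d) :
    MeasurePreserving f (multivariateGaussian 0 (τ ^ 2 • (1 : Matrix (Fin d) (Fin d) ℝ)))
      (multivariateGaussian 0 (τ ^ 2 • (1 : Matrix (Fin d) (Fin d) ℝ))) := by
  refine ⟨f.continuous.measurable, ?_⟩
  have hf : Measurable f := f.continuous.measurable
  have hτ : Measurable fun x : E d => τ • x := by fun_prop
  have hcomm : f ∘ (fun x : E d => τ • x) = (fun x : E d => τ • x) ∘ f := by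
    ext1 x; simp
  conv_rhs => rw [multivariateGaussian_eq_map, ← stdGaussian_map f, Measure.map_map hτ hf]
  rw [multivariateGaussian_eq_map, Measure.map_map hf hτ, hcomm]

theorem exists_isometry_apply_eq {x y : E d} (h : ‖x‖ = ‖y‖) :
    ∃ f : E d ≃ₗᵢ[ℝ] E d, f x = y :=
  ⟨Submodule.reflection (Submodule.span ℝ {x - y})ᗮ, Submodule.reflection_sub h⟩

theorem share_smul (U : Submodule ℝ (E d)) {c : ℝ} (hc : c ≠ 0) (x : E d) :
    share U (c • x) = share U x := by
  rw [share, share, map_smul, norm_smul, norm_smul, mul_pow, mul_pow, mul_div_mul_left]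
  simpa using hc

theorem share_map (U : Submodule ℝ (E d)) (f : E d ≃ₗᵢ[ℝ] E d) (x : E d) :
    share (U.map (f.toLinearEquiv : E d →ₗ[ℝ] E d)) (f x) = share U x := by
  rw [share, share, Submodule.starProjection_map_apply, f.symm_apply_apply, f.norm_map, f.norm_map]

/-- For a random subspace with rotation invariant law, the share of a fixed vector `b` in it has
the same law as the share of an independent Gaussian vector, because the law of the share does not
depend on the direction of the vector. Hence bounds for fixed subspaces and Gaussian vectors carry
over. -/
theorem measure_share_mem_le {H : Type*} [MeasurableSpace H] (P : Measure H)
    [IsProbabilityMeasure P] (V : H → Submodule ℝ (E d))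
    (hV : Measurable fun q : H × E d => share (V q.1) q.2)
    (hrot : ∀ f : E d ≃ₗᵢ[ℝ] E d, ∃ T : H → H, MeasurePreserving T P P ∧
      ∀ h, V (T h) = (V h).map (f.toLinearEquiv : E d →ₗ[ℝ] E d))
    {b : E d} (hb : b ≠ 0) {R : Set ℝ} (hR : MeasurableSet R) {ε : ENNReal}
    (hε : ∀ᵐ h ∂P, stdGaussian (E d) {x | share (V h) x ∈ R} ≤ ε) :
    P {h | share (V h) b ∈ R} ≤ ε := by
  have hconst : ∀ x : E d, x ≠ 0 → P {h | share (V h) x ∈ R} = P {h | share (V h) b ∈ R} := by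
    intro x hx
    have hbn : ‖b‖ ≠ 0 := norm_ne_zero_iff.2 hb
    have hxn : ‖x‖ ≠ 0 := norm_ne_zero_iff.2 hx
    have hc : ‖x‖ / ‖b‖ ≠ 0 := div_ne_zero hxn hbn
    obtain ⟨f, hf⟩ := exists_isometry_apply_eq (x := (‖x‖ / ‖b‖) • b) (y := x) (by
      rw [norm_smul, norm_div, norm_norm, norm_norm, div_mul_cancel₀ _ hbn])
    obtain ⟨T, hT, hVT⟩ := hrot f
    have hms : MeasurableSet {h | share (V h) x ∈ R} :=
      (hV.comp (measurable_id.prodMk measurable_const)) hR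
    rw [← hT.measure_preimage hms.nullMeasurableSet]
    congr 1
    ext h
    simp only [Set.mem_preimage, Set.mem_ofPred_eq]
    rw [hVT, ← hf, share_map, share_smul _ hc]
  have hne : ∀ᵐ x ∂stdGaussian (E d), x ≠ 0 := by
    have hbot : (⊥ : Submodule ℝ (E d)) ≠ ⊤ := fun h => hb (by
      have : b ∈ (⊥ : Submodule ℝ (E d)) := h ▸ Submodule.mem_top
      simpa using this)
    have := stdGaussian_submodule hbot
    rw [ae_iff]
    simpa using this
  have hS : MeasurableSet {q : H × E d | share (V q.1) q.2 ∈ R} := hV hR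
  calc P {h | share (V h) b ∈ R}
      = ∫⁻ _, P {h | share (V h) b ∈ R} ∂stdGaussian (E d) := by simp
    _ = ∫⁻ x, P {h | share (V h) x ∈ R} ∂stdGaussian (E d) :=
        lintegral_congr_ae (hne.mono fun x hx => (hconst x hx).symm)
    _ = (P.prod (stdGaussian (E d))) {q : H × E d | share (V q.1) q.2 ∈ R} :=
        (Measure.prod_apply_symm hS).symm
    _ = ∫⁻ h, stdGaussian (E d) {x | share (V h) x ∈ R} ∂P := Measure.prod_apply hS
    _ ≤ ∫⁻ _, ε ∂P := lintegral_mono_ae hε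
    _ = ε := by simp

end Gaussian

/-! ### Random spans -/

section Span

variable {d M : ℕ}

open InnerProductSpace in
/-- The projection onto a span through the Gram–Schmidt vectors. It holds for dependent families too
(the zero vectors contribute nothing), which makes the projection measurable in the family. -/
theorem starProjection_span_eq_sum_gramSchmidt (g : Fin M → E d) (x : E d) :
    (Submodule.span ℝ (Set.range g)).starProjection x
      = ∑ i, (inner ℝ (gramSchmidt ℝ g i) x / ‖gramSchmidt ℝ g i‖ ^ 2 : ℝ) • gramSchmidt ℝ g i := by
  rw [← span_gramSchmidt ℝ g]
  set v := gramSchmidt ℝ g with hv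
  refine (Submodule.eq_starProjection_of_mem_of_inner_eq_zero
    (Submodule.sum_mem _ fun i _ => Submodule.smul_mem _ _ (Submodule.subset_span ⟨i, rfl⟩))
    fun w hw => ?_)
  induction hw using Submodule.span_induction with
  | mem w hw =>
    obtain ⟨j, rfl⟩ := hw
    rw [inner_sub_left, sum_inner, Finset.sum_eq_single j, inner_smul_left,
      real_inner_self_eq_norm_sq, real_inner_comm, sub_eq_zero]
    · rcases eq_or_ne (v j) 0 with h0 | h0
      · simp [h0]
      · have : ‖v j‖ ≠ 0 := norm_ne_zero_iff.2 h0
        simp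
        field_simp
    · intro i _ hij
      rw [inner_smul_left, gramSchmidt_orthogonal ℝ g hij, mul_zero]
    · simp
  | zero => simp
  | add x y _ _ hx hy => rw [inner_add_right, hx, hy, add_zero]
  | smul c x _ hx => rw [inner_smul_right, hx, mul_zero]

theorem measurable_gramSchmidt (i : Fin M) :
    Measurable fun g : Fin M → E d => InnerProductSpace.gramSchmidt ℝ g i := by
  induction i using WellFoundedLT.induction with
  | ind i ih =>
    have h : ∀ g : Fin M → E d, InnerProductSpace.gramSchmidt ℝ g i
        = g i - ∑ j ∈ Finset.Iio i, (inner ℝ (InnerProductSpace.gramSchmidt ℝ g j) (g i)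
          / ‖InnerProductSpace.gramSchmidt ℝ g j‖ ^ 2 : ℝ) • InnerProductSpace.gramSchmidt ℝ g j :=
      fun g => by
        rw [InnerProductSpace.gramSchmidt_def ℝ g i]
        simp_rw [Submodule.starProjection_singleton]
        rfl
    simp_rw [h]
    refine (measurable_pi_apply i).sub (Finset.measurable_sum _ fun j hj => ?_)
    have hj := ih j (Finset.mem_Iio.1 hj)
    have hin : Measurable fun g : Fin M → E d =>
        (inner ℝ (InnerProductSpace.gramSchmidt ℝ g j) (g i) : ℝ) :=
      hj.inner (measurable_pi_apply i)
    exact (hin.div (hj.norm.pow_const 2)).smul hj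

theorem measurable_starProjection_span {H : Type*} [MeasurableSpace H] {g : H → Fin M → E d}
    {x : H → E d} (hg : Measurable g) (hx : Measurable x) :
    Measurable fun h => (Submodule.span ℝ (Set.range (g h))).starProjection (x h) := by
  simp_rw [starProjection_span_eq_sum_gramSchmidt]
  refine Finset.measurable_sum _ fun i _ => ?_
  have hi := (measurable_gramSchmidt i).comp hg
  exact ((hi.inner hx).div (hi.norm.pow_const 2)).smul hi

theorem measurable_share_span {H : Type*} [MeasurableSpace H] {g : H → Fin M → E d}
    (hg : Measurable g) :
    Measurable fun q : H × E d => share (Submodule.span ℝ (Set.range (g q.1))) q.2 :=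
  ((measurable_starProjection_span (hg.comp measurable_fst) measurable_snd).norm.pow_const 2).div
    (measurable_snd.norm.pow_const 2)

/-- Resampling one coordinate of a product measure. -/
theorem measurePreserving_update {ι α : Type*} [Fintype ι] [DecidableEq ι] [MeasurableSpace α]
    (μ : Measure α) [IsProbabilityMeasure μ] (j : ι) :
    MeasurePreserving (fun p : (ι → α) × α => Function.update p.1 j p.2)
      ((Measure.pi fun _ => μ).prod μ) (Measure.pi fun _ => μ) := by
  have hm : Measurable fun p : (ι → α) × α => Function.update p.1 j p.2 := by
    refine measurable_pi_iff.2 fun i => ?_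
    rcases eq_or_ne i j with rfl | hij
    · simpa using measurable_snd
    · simp only [Function.update_of_ne hij]
      exact (measurable_pi_apply i).comp measurable_fst
  refine ⟨hm, (Measure.pi_eq fun s hs => ?_).symm⟩
  have hpre : (fun p : (ι → α) × α => Function.update p.1 j p.2) ⁻¹' (Set.univ.pi s)
      = (Set.univ.pi (Function.update s j Set.univ)) ×ˢ s j := by
    ext p
    simp only [Set.mem_preimage, Set.mem_pi, Set.mem_univ, true_imp_iff, Set.mem_prod]
    constructor
    · refine fun h => ⟨fun i => ?_, by simpa using h j⟩
      rcases eq_or_ne i j with rfl | hij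
      · simp
      · simpa [Function.update_of_ne hij] using h i
    · rintro ⟨h1, h2⟩ i
      rcases eq_or_ne i j with rfl | hij
      · simpa using h2
      · simpa [Function.update_of_ne hij] using h1 i
  rw [Measure.map_apply hm (MeasurableSet.univ_pi hs), hpre, Measure.prod_prod, Measure.pi_pi,
    ← Finset.mul_prod_erase _ _ (Finset.mem_univ j), ← Finset.mul_prod_erase _ _ (Finset.mem_univ j),
    Function.update_self, measure_univ, one_mul, mul_comm]
  congr 1
  refine Finset.prod_congr rfl fun i hi => ?_
  rw [Function.update_of_ne (Finset.ne_of_mem_erase hi)]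

/-- Fewer than `d` independent Gaussian vectors are almost surely such that none lies in the span
of the others: given the others, their span is a null set. -/
theorem ae_notMem_span_update {μ : Measure (E d)} [IsProbabilityMeasure μ]
    (hμ : ∀ U : Submodule ℝ (E d), U ≠ ⊤ → μ (U : Set (E d)) = 0) (hMd : M < d) (j : Fin M) :
    ∀ᵐ g ∂(Measure.pi fun _ : Fin M => μ),
      g j ∉ Submodule.span ℝ (Set.range (Function.update g j 0)) := by
  have hupd : Measurable fun g : Fin M → E d => Function.update g j 0 :=
    measurable_pi_iff.2 fun i => by
      rcases eq_or_ne i j with rfl | hij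
      · simp
      · simpa [Function.update_of_ne hij] using measurable_pi_apply i
  have hms : ∀ {H : Type} [MeasurableSpace H] (g : H → Fin M → E d) (x : H → E d), Measurable g →
      Measurable x → MeasurableSet {h | x h ∈ Submodule.span ℝ (Set.range (g h))} := by
    intro H _ g x hg hx
    simp_rw [← Submodule.starProjection_eq_self_iff]
    exact measurableSet_eq_fun (measurable_starProjection_span hg hx) hx
  rw [ae_iff]
  simp only [not_not]
  rw [← (measurePreserving_update μ j).measure_preimage
    (hms _ _ hupd (measurable_pi_apply j)).nullMeasurableSet]
  have hpre : (fun p : (Fin M → E d) × E d => Function.update p.1 j p.2) ⁻¹'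
      {g | g j ∈ Submodule.span ℝ (Set.range (Function.update g j 0))}
      = {p | p.2 ∈ Submodule.span ℝ (Set.range (Function.update p.1 j 0))} := by
    ext p; simp
  rw [hpre, Measure.measure_prod_null
    (hms (fun p : (Fin M → E d) × E d => Function.update p.1 j 0) _ (hupd.comp measurable_fst)
      measurable_snd)]
  refine .of_forall fun g =>
    hμ (Submodule.span ℝ (Set.range (Function.update g j 0))) fun htop => ?_
  have h1 := finrank_range_le_card (R := ℝ) (Function.update g j 0)
  rw [Set.finrank, htop, finrank_top, finrank_euclideanSpace_fin, Fintype.card_fin] at h1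
  omega

variable [NeZero M]

/-- The span of all entries of `g` but the one with index `0`. -/
def tailSpan (g : Fin M → E d) : Submodule ℝ (E d) :=
  Submodule.span ℝ (Set.range (Function.update g 0 0))

theorem tailSpan_eq (g : Fin M → E d) :
    tailSpan g = Submodule.span ℝ (Set.range fun i : {i : Fin M // i ≠ 0} => g i) := by
  apply le_antisymm
  · rw [tailSpan, Submodule.span_le]
    rintro _ ⟨i, rfl⟩
    rcases eq_or_ne i 0 with rfl | hi
    · simp
    · rw [Function.update_of_ne hi]
      exact Submodule.subset_span ⟨⟨i, hi⟩, rfl⟩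
  · refine Submodule.span_mono ?_
    rintro _ ⟨i, rfl⟩
    exact ⟨i, Function.update_of_ne i.2 _ _⟩

theorem ae_finrank_tailSpan {μ : Measure (E d)} [IsProbabilityMeasure μ]
    (hμ : ∀ U : Submodule ℝ (E d), U ≠ ⊤ → μ (U : Set (E d)) = 0) (hMd : M < d) :
    ∀ᵐ g ∂(Measure.pi fun _ : Fin M => μ), Module.finrank ℝ (tailSpan g) = M - 1 := by
  filter_upwards [ae_all_iff.2 fun j => ae_notMem_span_update hμ hMd j] with g hg
  have hli : LinearIndependent ℝ fun i : {i : Fin M // i ≠ 0} => g i := by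
    rw [linearIndependent_iff_notMem_span]
    refine fun j hj => hg j ?_
    refine Submodule.span_mono ?_ hj
    rintro _ ⟨i, hi, rfl⟩
    refine ⟨i, Function.update_of_ne (fun h => hi.2 (Subtype.ext h)) _ _⟩
  rw [tailSpan_eq, finrank_span_eq_card hli]
  simp

theorem measurable_update_zero :
    Measurable fun g : Fin M → E d => Function.update g 0 0 :=
  measurable_pi_iff.2 fun i => by
    rcases eq_or_ne i 0 with rfl | hi
    · simp
    · simpa [Function.update_of_ne hi] using measurable_pi_apply i

theorem measurable_share_tailSpan :
    Measurable fun q : (Fin M → E d) × E d => share (tailSpan q.1) q.2 := by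
  unfold tailSpan
  exact measurable_share_span (g := fun g : Fin M → E d => Function.update g 0 0)
    measurable_update_zero

theorem update_comp_isometry (g : Fin M → E d) (f : E d ≃ₗᵢ[ℝ] E d) :
    Function.update (fun i => f (g i)) 0 0 = fun i => f (Function.update g 0 0 i) := by
  ext1 i
  rcases eq_or_ne i 0 with rfl | hi
  · simp
  · simp [Function.update_of_ne hi]

theorem tailSpan_comp_isometry (g : Fin M → E d) (f : E d ≃ₗᵢ[ℝ] E d) :
    tailSpan (fun i => f (g i)) = (tailSpan g).map (f.toLinearEquiv : E d →ₗ[ℝ] E d) := by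
  rw [tailSpan, tailSpan, Submodule.map_span, update_comp_isometry, ← Set.range_comp]
  rfl

/-- The covariate shift between source `m` and the target when the entry `0` of `g` is the vector
`ξ` and the others are the differences to the first source. -/
noncomputable def shift (m : Fin M) (g : Fin M → E d) : E d :=
  Function.update g 0 0 m - (tailSpan g).starProjection (g 0)

theorem measurable_shift (m : Fin M) : Measurable (shift m : (Fin M → E d) → E d) :=
  ((measurable_pi_apply m).comp measurable_update_zero).sub
    (measurable_starProjection_span measurable_update_zero (measurable_pi_apply 0))

theorem shift_comp_isometry (m : Fin M) (g : Fin M → E d) (f : E d ≃ₗᵢ[ℝ] E d) :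
    shift m (fun i => f (g i)) = f (shift m g) := by
  simp only [shift, tailSpan_comp_isometry, Submodule.starProjection_map_apply,
    f.symm_apply_apply, update_comp_isometry, map_sub]

end Span

/-! ### The event of high probability -/

section Event

variable {d M : ℕ}

/-- The upper tail of the share of a Gaussian vector in a line; `v = 0` is allowed, where the share
is `0`. -/
theorem stdGaussian_share_span_singleton_le (hd : 2 ≤ d) {t : ℝ} (ht : 1 ≤ t) (htd : t < d)
    (v : E d) :
    stdGaussian (E d) {x | share (Submodule.span ℝ {v}) x ∈ Set.Ioi (t / d)}
      ≤ ENNReal.ofReal (Real.exp (1 / 2 * (1 - t + Real.log t))) := by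
  have hd0 : (0 : ℝ) < d := by linarith
  rcases eq_or_ne v 0 with rfl | hv
  · have : {x : E d | share (Submodule.span ℝ {(0 : E d)}) x ∈ Set.Ioi (t / d)} = ∅ := by
      refine Set.eq_empty_of_forall_notMem fun x hx => ?_
      have hpos : 0 < t / d := by positivity
      simp [share] at hx
      linarith
    rw [this]; simp
  · have hr : Module.finrank ℝ (Submodule.span ℝ {v}) = 1 := finrank_span_singleton hv
    have h := stdGaussian_share_le (Submodule.span ℝ {v}) (β := t) (by linarith) (by omega)
      (by rw [hr]; simpa using htd) {x | share (Submodule.span ℝ {v}) x ∈ Set.Ioi (t / d)}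
      (fun x hx => by
        rw [hr]
        refine mul_nonneg (by linarith) ?_
        have : t / d < share (Submodule.span ℝ {v}) x := hx
        simp only [Nat.cast_one, one_mul]
        linarith)
    rw [hr] at h
    simpa using h

/-- In the range where the target probability is positive, the two tails of the share of `b` in
`V` cost at most half of the allowed failure probability. -/
theorem exp_dim_tails_le {M d : ℕ} (h : 2 * Real.exp (-(d : ℝ) / 32)
    + 2 * Real.exp (-(M : ℝ) / 32) < 1) :
    Real.exp (((M : ℝ) - 1) / 2 * (1 - 3 + Real.log 3))
      + Real.exp (((M : ℝ) - 1) / 2 * (1 - 1 / 3 + Real.log (1 / 3)))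
      ≤ (2 * Real.exp (-(d : ℝ) / 32) + 2 * Real.exp (-(M : ℝ) / 32)) / 2 := by
  have hd := Real.exp_pos (-(d : ℝ) / 32)
  have hM := Real.add_one_le_exp (-(M : ℝ) / 32)
  have hM16 : 16 < (M : ℝ) := by linarith
  have h1 := Real.log_three_gt_d9
  have h2 := Real.log_three_lt_d9
  have h3 : Real.log (1 / 3) = -Real.log 3 := by rw [one_div, Real.log_inv]
  have key : ∀ c : ℝ, c ≤ -0.4 →
      Real.exp (((M : ℝ) - 1) / 2 * c) ≤ Real.exp (-(M : ℝ) / 32) / 2 := by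
    intro c hc
    have : ((M : ℝ) - 1) / 2 * c ≤ -(M : ℝ) / 32 + -Real.log 2 := by
      have h4 := Real.log_two_lt_d9
      nlinarith
    calc Real.exp (((M : ℝ) - 1) / 2 * c) ≤ Real.exp (-(M : ℝ) / 32 + -Real.log 2) :=
          Real.exp_le_exp.2 this
      _ = Real.exp (-(M : ℝ) / 32) / 2 := by
          rw [Real.exp_add, Real.exp_neg (Real.log 2), Real.exp_log two_pos, ← div_eq_mul_inv]
  have h5 := key (1 - 3 + Real.log 3) (by linarith)
  have h6 := key (1 - 1 / 3 + Real.log (1 / 3)) (by rw [h3]; linarith)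
  linarith

/-- A target probability that is positive forces `t` to be bounded below. -/
theorem lt_of_exp_line_lt_one {t : ℝ} (h : Real.exp (-t / 16) + 2 * Real.exp (-t / 4) < 1) :
    5.6 < t := by
  have h4 : Real.exp (-t / 4) = Real.exp (-t / 16) ^ 4 := by
    rw [← Real.exp_nat_mul]; congr 1; push_cast; ring
  rw [h4] at h
  have hy : Real.exp (-t / 16) < 0.65 := by
    by_contra! hy
    have : (0.65 : ℝ) ^ 4 ≤ Real.exp (-t / 16) ^ 4 := pow_le_pow_left₀ (by norm_num) hy 4
    norm_num at this
    linarith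
  have := Real.add_one_le_exp (-t / 16)
  linarith

/-- In the range where the target probability is positive, the tail of the share of `b` in a random
line costs at most half of the allowed failure probability. -/
theorem exp_line_tail_le {t : ℝ} (h : Real.exp (-t / 16) + 2 * Real.exp (-t / 4) < 1) :
    Real.exp (1 / 2 * (1 - t + Real.log t))
      ≤ (Real.exp (-t / 16) + 2 * Real.exp (-t / 4)) / 2 := by
  have ht := lt_of_exp_line_lt_one h
  -- the tangent of the logarithm at `8 = 2 ^ 3`
  have hlog : Real.log t ≤ 3 * Real.log 2 + t / 8 - 1 := by
    have h1 := Real.log_le_sub_one_of_pos (show 0 < t / 8 by linarith)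
    rw [Real.log_div (by linarith) (by norm_num), show (8 : ℝ) = 2 ^ 3 by norm_num,
      Real.log_pow] at h1
    push_cast at h1
    linarith
  have h2 := Real.log_two_lt_d9
  have : 1 / 2 * (1 - t + Real.log t) ≤ -t / 16 + -Real.log 2 := by linarith
  calc Real.exp (1 / 2 * (1 - t + Real.log t)) ≤ Real.exp (-t / 16 + -Real.log 2) :=
        Real.exp_le_exp.2 this
    _ = Real.exp (-t / 16) / 2 := by
        rw [Real.exp_add, Real.exp_neg (Real.log 2), Real.exp_log two_pos, ← div_eq_mul_inv]
    _ ≤ _ := by linarith [Real.exp_pos (-t / 4)]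

variable [NeZero M]

/-- For a Gaussian family, the three ways in which the geometry can fail: the dimension of `V`, the
share of `b` in `V`, or the share of `b` in the direction of the covariate shift. The three
probabilities add up, so no independence between them is needed. -/
theorem measure_bad_le {μ : Measure (E d)} [IsProbabilityMeasure μ]
    (hμ : ∀ U : Submodule ℝ (E d), U ≠ ⊤ → μ (U : Set (E d)) = 0)
    (hrot : ∀ f : E d ≃ₗᵢ[ℝ] E d, MeasurePreserving f μ μ)
    (hMd : 6 * M ≤ d) {t : ℝ} (ht : 1 ≤ t) (htd : t < d) (m : Fin M) {b : E d} (hb : b ≠ 0) :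
    (Measure.pi fun _ : Fin M => μ)
        ({g | Module.finrank ℝ (tailSpan g) ≠ M - 1}
          ∪ {g | share (tailSpan g) b ∈ Set.Ioi (((M : ℝ) - 1) * 3 / d)}
          ∪ {g | share (tailSpan g) b ∈ Set.Iio (((M : ℝ) - 1) * (1 / 3) / d)}
          ∪ {g | share (Submodule.span ℝ {shift m g}) b ∈ Set.Ioi (t / d)})
      ≤ ENNReal.ofReal (Real.exp (((M : ℝ) - 1) / 2 * (1 - 3 + Real.log 3))
          + Real.exp (((M : ℝ) - 1) / 2 * (1 - 1 / 3 + Real.log (1 / 3)))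
          + Real.exp (1 / 2 * (1 - t + Real.log t))) := by
  have hM1 : 1 ≤ M := NeZero.one_le
  have hMR : (1 : ℝ) ≤ M := by exact_mod_cast hM1
  have hMdR : 6 * (M : ℝ) ≤ d := by exact_mod_cast hMd
  have hrank := ae_finrank_tailSpan (M := M) hμ (by omega)
  have hT : ∀ f : E d ≃ₗᵢ[ℝ] E d, MeasurePreserving (fun (g : Fin M → E d) i => f (g i))
      (Measure.pi fun _ => μ) (Measure.pi fun _ => μ) := fun f =>
    measurePreserving_pi _ _ fun _ => hrot f
  have h0 : (Measure.pi fun _ : Fin M => μ) {g | Module.finrank ℝ (tailSpan g) ≠ M - 1} = 0 := hrank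
  have hV : ∀ {β : ℝ}, 0 < β → β ≤ 3 → ∀ {R : Set ℝ}, MeasurableSet R →
      (∀ r ∈ R, 0 ≤ (β - 1) * (r - ((M : ℝ) - 1) * β / d)) →
      (Measure.pi fun _ : Fin M => μ) {g | share (tailSpan g) b ∈ R}
        ≤ ENNReal.ofReal (Real.exp (((M : ℝ) - 1) / 2 * (1 - β + Real.log β))) := by
    intro β hβ hβ3 R hR hs
    have hVrot : ∀ f : E d ≃ₗᵢ[ℝ] E d, ∃ T : (Fin M → E d) → Fin M → E d,
        MeasurePreserving T (Measure.pi fun _ => μ) (Measure.pi fun _ => μ) ∧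
        ∀ g, tailSpan (T g) = (tailSpan g).map (f.toLinearEquiv : E d →ₗ[ℝ] E d) :=
      fun f => ⟨fun g i => f (g i), hT f, fun g => tailSpan_comp_isometry g f⟩
    refine measure_share_mem_le _ tailSpan measurable_share_tailSpan hVrot hb hR ?_
    filter_upwards [hrank] with g hg
    have hcast : (Module.finrank ℝ (tailSpan g) : ℝ) = (M : ℝ) - 1 := by
      rw [hg, Nat.cast_sub hM1, Nat.cast_one]
    have := stdGaussian_share_le (tailSpan g) hβ (by omega)
      (by rw [hcast]; nlinarith) {x | share (tailSpan g) x ∈ R}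
      (fun x hx => by rw [hcast]; exact hs _ hx)
    rwa [hcast] at this
  have h1 := hV (β := 3) (by norm_num) le_rfl measurableSet_Ioi (fun r hr => by
    have : ((M : ℝ) - 1) * 3 / d < r := hr
    exact mul_nonneg (by norm_num) (by linarith))
  have h2 := hV (β := 1 / 3) (by norm_num) (by norm_num) measurableSet_Iio (fun r hr => by
    have : r < ((M : ℝ) - 1) * (1 / 3) / d := hr
    exact mul_nonneg_of_nonpos_of_nonpos (by norm_num) (by linarith))
  have h3 : (Measure.pi fun _ : Fin M => μ)
      {g | share (Submodule.span ℝ {shift m g}) b ∈ Set.Ioi (t / d)}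
      ≤ ENNReal.ofReal (Real.exp (1 / 2 * (1 - t + Real.log t))) := by
    have hmeas : Measurable fun q : (Fin M → E d) × E d =>
        share (Submodule.span ℝ {shift m q.1}) q.2 := by
      have : Measurable fun g : Fin M → E d => (fun _ : Fin 1 => shift m g) :=
        measurable_pi_iff.2 fun _ => measurable_shift m
      simpa using measurable_share_span this
    have hVrot : ∀ f : E d ≃ₗᵢ[ℝ] E d, ∃ T : (Fin M → E d) → Fin M → E d,
        MeasurePreserving T (Measure.pi fun _ => μ) (Measure.pi fun _ => μ) ∧
        ∀ g, Submodule.span ℝ {shift m (T g)}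
          = (Submodule.span ℝ {shift m g}).map (f.toLinearEquiv : E d →ₗ[ℝ] E d) := by
      refine fun f => ⟨fun g i => f (g i), hT f, fun g => ?_⟩
      rw [shift_comp_isometry, Submodule.map_span, Set.image_singleton]
      rfl
    exact measure_share_mem_le _ (fun g => Submodule.span ℝ {shift m g}) hmeas hVrot hb
      measurableSet_Ioi
      (.of_forall fun g => stdGaussian_share_span_singleton_le (by omega) ht htd _)
  have he : ∀ x : ℝ, 0 ≤ Real.exp x := fun x => (Real.exp_pos x).le
  rw [ENNReal.ofReal_add (add_nonneg (he _) (he _)) (he _), ENNReal.ofReal_add (he _) (he _)]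
  refine (measure_union_le _ _).trans (add_le_add ((measure_union_le _ _).trans (add_le_add
    ((measure_union_le _ _).trans ?_) h2)) h3)
  rw [h0, zero_add]
  exact h1

/-- With the stated probability, `V` has full dimension, and both `V` and the direction of the
covariate shift contain a share of `b` of the expected order. -/
theorem exists_event {Ω : Type*} [MeasurableSpace Ω] (Pr : Measure Ω) [IsProbabilityMeasure Pr]
    {μ : Measure (E d)} [IsProbabilityMeasure μ]
    (hμ : ∀ U : Submodule ℝ (E d), U ≠ ⊤ → μ (U : Set (E d)) = 0)
    (hrot : ∀ f : E d ≃ₗᵢ[ℝ] E d, MeasurePreserving f μ μ)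
    {G : Ω → Fin M → E d} (hG : AEMeasurable G Pr)
    (hlaw : Pr.map G = Measure.pi fun _ => μ)
    (hMd : 6 * M ≤ d) {t : ℝ} (htd : t ≤ (d : ℝ) / 2) (m : Fin M) (b : E d) :
    ∃ A : Set Ω, MeasurableSet A ∧
      max 0 (1 - 2 * Real.exp (-(d : ℝ) / 32) - 2 * Real.exp (-(M : ℝ) / 32))
          * max 0 (1 - Real.exp (-t / 16) - 2 * Real.exp (-t / 4)) ≤ Pr.real A ∧
      ∀ ω ∈ A,
        Module.finrank ℝ (tailSpan (G ω)) = M - 1 ∧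
        ‖(tailSpan (G ω)).starProjection b‖ ^ 2 ≤ 3 * ((M : ℝ) - 1) / d * ‖b‖ ^ 2 ∧
        ((M : ℝ) - 1) / (3 * d) * ‖b‖ ^ 2 ≤ ‖(tailSpan (G ω)).starProjection b‖ ^ 2 ∧
        (inner ℝ (unit (shift m (G ω))) b : ℝ) ^ 2 ≤ t / d * ‖b‖ ^ 2 := by
  -- If one of the factors vanishes, the empty event will do.
  by_cases hq1 : 1 - 2 * Real.exp (-(d : ℝ) / 32) - 2 * Real.exp (-(M : ℝ) / 32) ≤ 0
  · exact ⟨∅, .empty, by simp [max_eq_left hq1], by simp⟩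
  by_cases hq2 : 1 - Real.exp (-t / 16) - 2 * Real.exp (-t / 4) ≤ 0
  · exact ⟨∅, .empty, by simp [max_eq_left hq2], by simp⟩
  push Not at hq1 hq2
  have ht := lt_of_exp_line_lt_one (t := t) (by linarith)
  have hM1 : 1 ≤ M := NeZero.one_le
  have hd0 : (0 : ℝ) < d := by exact_mod_cast (by omega : 0 < d)
  -- The conditions on `b` hold trivially if `b = 0`, where the share is a junk value.
  rcases eq_or_ne b 0 with rfl | hb
  · refine ⟨(toMeasurable Pr (G ⁻¹' {g | Module.finrank ℝ (tailSpan g) ≠ M - 1}))ᶜ,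
      (measurableSet_toMeasurable _ _).compl, ?_, fun ω hω => ?_⟩
    · have hnull : Pr (G ⁻¹' {g | Module.finrank ℝ (tailSpan g) ≠ M - 1}) = 0 := by
        refine le_antisymm ((Measure.le_map_apply hG _).trans ?_) bot_le
        rw [hlaw]
        exact (ae_finrank_tailSpan (M := M) hμ (by omega)).le
      rw [probReal_compl_eq_one_sub (measurableSet_toMeasurable _ _), measureReal_def,
        measure_toMeasurable, hnull, max_eq_right hq1.le, max_eq_right hq2.le]
      have := Real.exp_pos (-(d : ℝ) / 32)
      have := Real.exp_pos (-(M : ℝ) / 32)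
      have := Real.exp_pos (-t / 16)
      have := Real.exp_pos (-t / 4)
      simp only [ENNReal.toReal_zero, sub_zero]
      exact mul_le_one₀ (by linarith) hq2.le (by linarith)
    · have : ω ∉ G ⁻¹' {g | Module.finrank ℝ (tailSpan g) ≠ M - 1} :=
        fun h => hω (subset_toMeasurable _ _ h)
      simp only [Set.mem_preimage, Set.mem_ofPred_eq, not_not] at this
      simp [this]
  have hbad := measure_bad_le (M := M) hμ hrot hMd (t := t) (by linarith) (by linarith) m hb
  set bad := {g | Module.finrank ℝ (tailSpan g) ≠ M - 1}
          ∪ {g | share (tailSpan g) b ∈ Set.Ioi (((M : ℝ) - 1) * 3 / d)}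
          ∪ {g | share (tailSpan g) b ∈ Set.Iio (((M : ℝ) - 1) * (1 / 3) / d)}
          ∪ {g | share (Submodule.span ℝ {shift m g}) b ∈ Set.Ioi (t / d)} with hbaddef
  -- `G` is only almost everywhere measurable, so the event is cut out by a measurable hull.
  refine ⟨(toMeasurable Pr (G ⁻¹' bad))ᶜ, (measurableSet_toMeasurable _ _).compl, ?_,
    fun ω hω => ?_⟩
  · have hPr : Pr (G ⁻¹' bad) ≤ _ := (Measure.le_map_apply hG _).trans (hlaw ▸ hbad)
    have hreal : Pr.real (toMeasurable Pr (G ⁻¹' bad))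
        ≤ Real.exp (((M : ℝ) - 1) / 2 * (1 - 3 + Real.log 3))
          + Real.exp (((M : ℝ) - 1) / 2 * (1 - 1 / 3 + Real.log (1 / 3)))
          + Real.exp (1 / 2 * (1 - t + Real.log t)) := by
      rw [measureReal_def, measure_toMeasurable]
      exact ENNReal.toReal_le_of_le_ofReal (by positivity) hPr
    rw [probReal_compl_eq_one_sub (measurableSet_toMeasurable _ _), max_eq_right hq1.le,
      max_eq_right hq2.le]
    have h1 := exp_dim_tails_le (M := M) (d := d) (by linarith)
    have h2 := exp_line_tail_le (t := t) (by linarith)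
    set q₁ := 2 * Real.exp (-(d : ℝ) / 32) + 2 * Real.exp (-(M : ℝ) / 32) with hq₁
    set q₂ := Real.exp (-t / 16) + 2 * Real.exp (-t / 4) with hq₂
    have hq₁0 : 0 ≤ q₁ := by positivity
    have hq₂0 : 0 ≤ q₂ := by positivity
    have e1 : 1 - 2 * Real.exp (-(d : ℝ) / 32) - 2 * Real.exp (-(M : ℝ) / 32) = 1 - q₁ := by
      rw [hq₁]; ring
    have e2 : 1 - Real.exp (-t / 16) - 2 * Real.exp (-t / 4) = 1 - q₂ := by rw [hq₂]; ring
    rw [e1] at hq1 ⊢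
    rw [e2] at hq2 ⊢
    -- `(1 - q₁)(1 - q₂) ≤ 1 - (q₁ + q₂) / 2` for `q₁, q₂` in the unit interval
    nlinarith [mul_nonneg hq₁0 hq2.le, mul_nonneg hq₂0 hq1.le]
  · have hω' : G ω ∉ bad := fun h => hω (subset_toMeasurable _ _ h)
    have hbn : 0 < ‖b‖ ^ 2 := by positivity
    simp only [hbaddef, Set.mem_union, not_or, Set.mem_ofPred_eq, Set.mem_Ioi, Set.mem_Iio,
      not_lt, not_not, share, norm_starProjection_span_singleton_sq] at hω'
    obtain ⟨⟨⟨h1, h2⟩, h3⟩, h4⟩ := hω'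
    rw [div_le_iff₀ hbn] at h2 h4
    rw [le_div_iff₀ hbn] at h3
    refine ⟨h1, h2.trans_eq (by ring), Eq.trans_le ?_ h3, h4⟩
    field_simp

end Event

/-! ### From the geometry to the risk bounds -/

theorem cipDen_mono {σ ρ Δ κ κ' : ℝ} (hρ : 0 < ρ) (hΔ : 0 ≤ Δ) (h : κ ≤ κ') :
    cipDen σ ρ Δ κ ≤ cipDen σ ρ Δ κ' := by
  unfold cipDen
  have : 0 ≤ ρ * (1 + Δ / σ ^ 2) := by positivity
  linarith [mul_le_mul_of_nonneg_left h this]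

theorem cipDen_pos {σ ρ Δ κ : ℝ} (hρ : 0 < ρ) (hΔ : 0 ≤ Δ) (h : 0 ≤ κ) :
    0 < cipDen σ ρ Δ κ := by
  unfold cipDen; positivity

theorem div_add_div_sq_bounds {a N D₁ D D₂ : ℝ} (ha : 0 ≤ a) (h0 : 0 < D₁) (h1 : D₁ ≤ D)
    (h2 : D ≤ D₂) :
    (0 ≤ N → a / D + N / D ^ 2 ≤ a / D₁ + N / D₁ ^ 2 ∧
      a / D₂ + N / D₂ ^ 2 ≤ a / D + N / D ^ 2) ∧
    (N < 0 → a / D + N / D ^ 2 ≤ a / D₁ + N / D₂ ^ 2 ∧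
      a / D₂ + N / D₁ ^ 2 ≤ a / D + N / D ^ 2) := by
  have hD : 0 < D := h0.trans_le h1
  have hD2 : 0 < D₂ := hD.trans_le h2
  have e1 : a / D ≤ a / D₁ := by gcongr
  have e2 : a / D₂ ≤ a / D := by gcongr
  refine ⟨fun hN => ⟨add_le_add e1 (by gcongr), add_le_add e2 (by gcongr)⟩,
    fun hN => ⟨add_le_add e1 ?_, add_le_add e2 ?_⟩⟩
  · have : -N / D₂ ^ 2 ≤ -N / D ^ 2 := by
      have : 0 ≤ -N := by linarith
      gcongr
    rw [neg_div, neg_div] at this; linarith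
  · have : -N / D ^ 2 ≤ -N / D₁ ^ 2 := by
      have : 0 ≤ -N := by linarith
      gcongr
    rw [neg_div, neg_div] at this; linarith

end AnticausalDA

theorem corollary4
    {d M : ℕ} [NeZero M] (hM : 2 ≤ M)
    (S : AnticausalDA.SCM d) (σ ρ : ℝ) (hσ : 0 < σ) (hρ : 0 < ρ)
    (hS : S.IsAnticausal σ ((σ ^ 2 / ρ) • (1 : Matrix (Fin d) (Fin d) ℝ)))
    (aY : Fin M → ℝ) (aYt : ℝ)
    (hY : ∀ m, ¬ (S.labelLaw (aY m) ⟂ₘ S.labelLaw (aY 0))) :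
    -- the exact risks, for fixed interventions
    (∀ (aX : Fin M → AnticausalDA.E d) (aXt : AnticausalDA.E d),
      Module.finrank ℝ (AnticausalDA.interSpan aX) < d →
      aXt - aX 0 ∈ AnticausalDA.interSpan aX →
      ((∃! p, AnticausalDA.IsOLS (S.law aXt aYt) p) ∧
        ∀ p, AnticausalDA.IsOLS (S.law aXt aYt) p →
          AnticausalDA.risk (S.law aXt aYt) (AnticausalDA.affine p)
            = σ ^ 2 / (1 + ρ * ‖S.b‖ ^ 2)) ∧
      ((∃! p, AnticausalDA.IsCIP (fun j => S.law (aX j) (aY j)) p) ∧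
        ∀ p, AnticausalDA.IsCIP (fun j => S.law (aX j) (aY j)) p →
          AnticausalDA.risk (S.law aXt aYt) (AnticausalDA.affine p)
            = (σ ^ 2 + AnticausalDA.deltaY aY) /
                AnticausalDA.cipDen σ ρ (AnticausalDA.deltaY aY)
                  (‖S.b‖ ^ 2 - ‖(AnticausalDA.interSpan aX).starProjection S.b‖ ^ 2)
              + AnticausalDA.excessY aY aYt /
                AnticausalDA.cipDen σ ρ (AnticausalDA.deltaY aY)
                  (‖S.b‖ ^ 2 - ‖(AnticausalDA.interSpan aX).starProjection S.b‖ ^ 2) ^ 2) ∧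
      ∀ m : Fin M,
        (S.b ∉ AnticausalDA.interSpan aX →
          ∃! p, AnticausalDA.IsCIRM (fun j => S.law (aX j) (aY j)) (S.law aXt aYt) m p) ∧
        ∀ p, AnticausalDA.IsCIRM (fun j => S.law (aX j) (aY j)) (S.law aXt aYt) m p →
          AnticausalDA.risk (S.law aXt aYt) (AnticausalDA.affine p)
            = σ ^ 2 / (1 + ρ * (‖S.b‖ ^ 2
                  - (inner ℝ (AnticausalDA.unit (aX m - aXt)) S.b : ℝ) ^ 2))
              + (aYt - aY m) ^ 2 / (1 + ρ * (‖S.b‖ ^ 2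
                  - (inner ℝ (AnticausalDA.unit (aX m - aXt)) S.b : ℝ) ^ 2)) ^ 2) ∧
    -- the bounds with high probability, for Gaussian interventions
    (∀ (Ω : Type*) [MeasurableSpace Ω] (Pr : MeasureTheory.Measure Ω)
      [MeasureTheory.IsProbabilityMeasure Pr] (τ t : ℝ)
      (aX : Fin M → Ω → AnticausalDA.E d) (aXt ξ : Ω → AnticausalDA.E d),
      0 < τ →
      -- entry `0` is `ξ`, the others are the differences `aX m - aX 0`
      ProbabilityTheory.iIndepFun
        (fun (m : Fin M) ω => if m = 0 then ξ ω else aX m ω - aX 0 ω) Pr →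
      (∀ m : Fin M, m ≠ 0 → ProbabilityTheory.HasLaw (fun ω => aX m ω - aX 0 ω)
        (ProbabilityTheory.multivariateGaussian 0
          (τ ^ 2 • (1 : Matrix (Fin d) (Fin d) ℝ))) Pr) →
      ProbabilityTheory.HasLaw ξ
        (ProbabilityTheory.multivariateGaussian 0
          (τ ^ 2 • (1 : Matrix (Fin d) (Fin d) ℝ))) Pr →
      (∀ ω, aXt ω - aX 0 ω
        = (AnticausalDA.interSpan (fun j => aX j ω)).starProjection (ξ ω)) →
      6 * M ≤ d → 0 < t → t ≤ (d : ℝ) / 2 →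
      ∀ m : Fin M, ∃ A : Set Ω, MeasurableSet A ∧
        max 0 (1 - 2 * Real.exp (-(d : ℝ) / 32) - 2 * Real.exp (-(M : ℝ) / 32))
            * max 0 (1 - Real.exp (-t / 16) - 2 * Real.exp (-t / 4)) ≤ Pr.real A ∧
        ∀ ω ∈ A,
          Module.finrank ℝ (AnticausalDA.interSpan (fun j => aX j ω)) = M - 1 ∧
          ((∃! p, AnticausalDA.IsCIP (fun j => S.law (aX j ω) (aY j)) p) ∧
            ∀ p, AnticausalDA.IsCIP (fun j => S.law (aX j ω) (aY j)) p →
              ∀ D₁ D₂ : ℝ,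
              D₁ = AnticausalDA.cipDen σ ρ (AnticausalDA.deltaY aY)
                    ((1 - 3 * ((M : ℝ) - 1) / d) * ‖S.b‖ ^ 2) →
              D₂ = AnticausalDA.cipDen σ ρ (AnticausalDA.deltaY aY)
                    ((1 - ((M : ℝ) - 1) / (3 * d)) * ‖S.b‖ ^ 2) →
              (0 ≤ AnticausalDA.excessY aY aYt →
                AnticausalDA.risk (S.law (aXt ω) aYt) (AnticausalDA.affine p)
                  ≤ (σ ^ 2 + AnticausalDA.deltaY aY) / D₁
                    + AnticausalDA.excessY aY aYt / D₁ ^ 2 ∧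
                (σ ^ 2 + AnticausalDA.deltaY aY) / D₂
                    + AnticausalDA.excessY aY aYt / D₂ ^ 2
                  ≤ AnticausalDA.risk (S.law (aXt ω) aYt) (AnticausalDA.affine p)) ∧
              (AnticausalDA.excessY aY aYt < 0 →
                AnticausalDA.risk (S.law (aXt ω) aYt) (AnticausalDA.affine p)
                  ≤ (σ ^ 2 + AnticausalDA.deltaY aY) / D₁
                    + AnticausalDA.excessY aY aYt / D₂ ^ 2 ∧
                (σ ^ 2 + AnticausalDA.deltaY aY) / D₂
                    + AnticausalDA.excessY aY aYt / D₁ ^ 2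
                  ≤ AnticausalDA.risk (S.law (aXt ω) aYt) (AnticausalDA.affine p))) ∧
          (S.b ≠ 0 → ∃! p,
            AnticausalDA.IsCIRM (fun j => S.law (aX j ω) (aY j)) (S.law (aXt ω) aYt) m p) ∧
          ∀ p, AnticausalDA.IsCIRM (fun j => S.law (aX j ω) (aY j)) (S.law (aXt ω) aYt) m p →
            AnticausalDA.risk (S.law (aXt ω) aYt) (AnticausalDA.affine p)
              ≤ σ ^ 2 / (1 + ρ * (1 - t / d) * ‖S.b‖ ^ 2)
                + (aYt - aY m) ^ 2 / (1 + ρ * (1 - t / d) * ‖S.b‖ ^ 2) ^ 2) := by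
  open AnticausalDA in
  refine ⟨fun aX aXt _ hsh => ⟨?_, ?_, fun m => ?_⟩, ?_⟩
  · obtain ⟨p₀, h1, h2⟩ := hS.exists_isOLS hσ hρ aXt aYt
    refine ⟨⟨p₀, (h1 p₀).2 rfl, fun q hq => (h1 q).1 hq⟩, fun p hp => ?_⟩
    rw [(h1 p).1 hp, h2]
  · obtain ⟨p₀, h1, -, -, h2⟩ := hS.exists_isCIP hσ hρ hY aYt hsh
    refine ⟨⟨p₀, (h1 p₀).2 rfl, fun q hq => (h1 q).1 hq⟩, fun p hp => ?_⟩
    rw [(h1 p).1 hp, h2]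
  · exact hS.existsUnique_isCIRM_and_risk hσ hρ hY aYt hsh m
  intro Ω _ Pr _ τ t aX aXt ξ hτ hind hlaw hξ hshift hMd ht htd m
  have hcoord : ∀ i : Fin M, HasLaw (fun ω => if i = 0 then ξ ω else aX i ω - aX 0 ω)
      (multivariateGaussian 0 (τ ^ 2 • (1 : Matrix (Fin d) (Fin d) ℝ))) Pr := by
    intro i
    by_cases hi : i = 0
    · simpa only [hi, if_true] using hξ
    · simpa only [hi, if_false] using hlaw i hi
  set G : Ω → Fin M → E d := fun ω i => if i = 0 then ξ ω else aX i ω - aX 0 ω with hG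
  have hGm : AEMeasurable G Pr := aemeasurable_pi_lambda _ fun i => (hcoord i).aemeasurable
  have hGlaw : Pr.map G = Measure.pi fun _ =>
      multivariateGaussian 0 (τ ^ 2 • (1 : Matrix (Fin d) (Fin d) ℝ)) := by
    rw [hG, hind.map_fun_eq_pi_map fun i => (hcoord i).aemeasurable]
    congr 1
    ext1 i
    exact (hcoord i).map_eq
  obtain ⟨A, hA, hPrA, hgood⟩ := exists_event (M := M) Pr
    (fun U hU => multivariateGaussian_submodule hτ.ne' hU)
    (measurePreserving_multivariateGaussian τ) hGm hGlaw hMd htd m S.b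
  refine ⟨A, hA, hPrA, fun ω hω => ?_⟩
  obtain ⟨hrank, hup, hlo, hline⟩ := hgood ω hω
  have hupd : Function.update (G ω) 0 0 = fun i => aX i ω - aX 0 ω := by
    ext1 i
    rcases eq_or_ne i 0 with rfl | hi
    · simp
    · simp [hG, hi]
  have hspan : tailSpan (G ω) = interSpan (fun j => aX j ω) := by
    rw [tailSpan, hupd, interSpan]
  have hG0 : G ω 0 = ξ ω := by simp [hG]
  have hsh' : shift m (G ω) = aX m ω - aXt ω := by
    simp only [shift, hupd, hspan, hG0]
    rw [← hshift ω]
    abel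
  rw [hsh'] at hline
  rw [hspan] at hrank
  simp only [hspan] at hup hlo
  have hsh : aXt ω - aX 0 ω ∈ interSpan (fun j => aX j ω) := by
    rw [hshift ω]; exact Submodule.starProjection_apply_mem _ _
  have hMR : (2 : ℝ) ≤ M := by exact_mod_cast hM
  have hMdR : 6 * (M : ℝ) ≤ d := by exact_mod_cast hMd
  have hd0 : (0 : ℝ) < d := by linarith
  have h3 : 3 * ((M : ℝ) - 1) / d < 1 := by rw [div_lt_one hd0]; linarith
  refine ⟨hrank, ?_, ?_, ?_⟩
  · obtain ⟨p₀, h1, -, -, h2⟩ := hS.exists_isCIP hσ hρ hY aYt hsh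
    refine ⟨⟨p₀, (h1 p₀).2 rfl, fun q hq => (h1 q).1 hq⟩, fun p hp D₁ D₂ hD₁ hD₂ => ?_⟩
    rw [(h1 p).1 hp, h2, hD₁, hD₂]
    have hΔ := deltaY_nonneg aY
    refine div_add_div_sq_bounds (by positivity) (cipDen_pos hρ hΔ ?_) (cipDen_mono hρ hΔ ?_)
      (cipDen_mono hρ hΔ ?_)
    · exact mul_nonneg (by linarith) (sq_nonneg _)
    · linarith
    · linarith
  · intro hb
    refine (hS.existsUnique_isCIRM_and_risk hσ hρ hY aYt hsh m).1 fun hmem => ?_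
    rw [Submodule.starProjection_eq_self_iff.2 hmem] at hup
    have : 0 < ‖S.b‖ ^ 2 := by positivity
    nlinarith
  · intro p hp
    rw [(hS.existsUnique_isCIRM_and_risk hσ hρ hY aYt hsh m).2 p hp]
    have ht1 : 0 ≤ 1 - t / d := by
      have : t / d ≤ 1 := by rw [div_le_one hd0]; linarith
      linarith
    have hK : 1 + ρ * (1 - t / d) * ‖S.b‖ ^ 2
        ≤ 1 + ρ * (‖S.b‖ ^ 2 - (inner ℝ (unit (aX m ω - aXt ω)) S.b : ℝ) ^ 2) := by
      have : (1 - t / d) * ‖S.b‖ ^ 2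
          ≤ ‖S.b‖ ^ 2 - (inner ℝ (unit (aX m ω - aXt ω)) S.b : ℝ) ^ 2 := by linarith
      rw [mul_assoc]
      linarith [mul_le_mul_of_nonneg_left this hρ.le]
    have hK0 : 0 < 1 + ρ * (1 - t / d) * ‖S.b‖ ^ 2 := by positivity
    gcongr
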